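/- A permutation group is a subgroup $A$ of the symmetric group $S_n$ of $\{1,\dots,n\}$; permutation groups are considered up to permutation isomorphism (a bijection of the base sets carrying one group onto the other). The direct sum $G\oplus H$ of permutation groups acts on the disjoint union of the base sets and consists of all permutations acting as an element of $G$ on the first set and, independently, as an element of $H$ on the second; similarly for finitely many summands. A permutation group is regular if it is transitive and all its point stabilizers are trivial. For a $k$-valued boolean function $f:\{0,1\}^n\to\{0,\dots,k-1\}$ its symmetry group is the group of all $\sigma\in S_n$ such that $f(x_{\sigma(1)},\dots,x_{\sigma(n)})=f(x_1,\dots,x_n)$ for all $x\in\{0,1\}^n$, and $BGR(k)$ is the class of all permutation groups that are symmetry groups of $k$-valued boolean functions. Let $C_i\le S_i$ be the group generated by the cycle $(1,2,\dots,i)$, and $K_4\le S_4$ the group generated by $(1,2)(3,4)$ and $(1,3)(2,4)$. Theorem. Let $A$ be a permutation group contained in a direct sum of finitely many regular permutation groups; every abelian permutation group has this property. If $A$ is different (up to permutation isomorphism) from $K_4, C_3, C_4, C_5$ and from every direct sum $C_i\oplus D$, where $i\in\{3,4,5\}$ and $D$ is a permutation group, then $A\in BGR(2)$. Otherwise, either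 $A\notin BGR(k)$ for every $k\ge 2$, or $A=K_4$ (up to permutation isomorphism) and $A\in BGR(3)$. -/

import Mathlib

namespace BoolSymm

/-- The permutation groups `G` on `X` and `H` on `Y` are permutation isomorphic: some bijection
`X ≃ Y` of the base sets carries `G` onto `H`. -/
def PermIso {X Y : Type*} (G : Subgroup (Equiv.Perm X)) (H : Subgroup (Equiv.Perm Y)) : Prop :=
  ∃ e : X ≃ Y, G.map (e.permCongrHom : Equiv.Perm X →* Equiv.Perm Y) = H

/-- The direct sum `G ⊕ H`: all permutations of the disjoint union of the base sets that act as an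
element of `G` on the first set and, independently, as an element of `H` on the second one. -/
def directSum {X Y : Type*} (G : Subgroup (Equiv.Perm X)) (H : Subgroup (Equiv.Perm Y)) :
    Subgroup (Equiv.Perm (X ⊕ Y)) :=
  (G.prod H).map (Equiv.Perm.sumCongrHom X Y)

/-- The direct sum of a family of permutation groups, acting on the disjoint union of their base
sets. -/
def iDirectSum {ι : Type*} {X : ι → Type*} (G : ∀ i, Subgroup (Equiv.Perm (X i))) :
    Subgroup (Equiv.Perm (Σ i, X i)) :=
  (Subgroup.pi Set.univ G).map (Equiv.Perm.sigmaCongrRightHom X)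

/-- A permutation group is regular if it is transitive and all its point stabilizers are trivial. -/
def IsRegularGroup {X : Type*} (G : Subgroup (Equiv.Perm X)) : Prop :=
  MulAction.IsPretransitive G X ∧ ∀ x : X, MulAction.stabilizer G x = ⊥

/-- `A` is, up to permutation isomorphism, contained in a direct sum of finitely many regular
permutation groups (of finite degree). -/
def ContainedInSumOfRegular {n : ℕ} (A : Subgroup (Equiv.Perm (Fin n))) : Prop :=
  ∃ (r : ℕ) (m : Fin r → ℕ) (B : ∀ i, Subgroup (Equiv.Perm (Fin (m i)))),
    (∀ i, IsRegularGroup (B i)) ∧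
    ∃ e : Fin n ≃ (Σ i, Fin (m i)),
      A.map (e.permCongrHom : Equiv.Perm (Fin n) →* Equiv.Perm (Σ i, Fin (m i))) ≤ iDirectSum B

/-- The symmetry group of a function `f` on `{0,1}ⁿ`: all `σ` with `f (x^σ) = f x` for every `x`,
where `x^σ = (x_{σ(1)}, …, x_{σ(n)})`. -/
def symmetryGroup {n : ℕ} {V : Type*} (f : (Fin n → Bool) → V) :
    Subgroup (Equiv.Perm (Fin n)) where
  carrier := {σ | ∀ x : Fin n → Bool, f (fun i => x (σ i)) = f x}
  one_mem' := fun _ => rfl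
  mul_mem' := fun {σ τ} hσ hτ x =>
    (hτ (fun i => x (σ i))).trans (hσ x)
  inv_mem' := fun {σ} hσ x => by
    have h := hσ (fun i => x (σ⁻¹ i))
    simpa using h.symm

/-- `A` belongs to `BGR(k)`: it is the symmetry group of a `k`-valued boolean function. -/
def Representable (k : ℕ) {n : ℕ} (A : Subgroup (Equiv.Perm (Fin n))) : Prop :=
  ∃ f : (Fin n → Bool) → Fin k, symmetryGroup f = A

/-- `C_i`, the group generated by the cycle `(1, 2, …, i)`. -/
def cyclicPerm (i : ℕ) : Subgroup (Equiv.Perm (Fin i)) :=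
  Subgroup.zpowers (finRotate i)

/-- `K_4`, the group generated by `(1,2)(3,4)` and `(1,3)(2,4)`. -/
def kleinPerm : Subgroup (Equiv.Perm (Fin 4)) :=
  Subgroup.closure
    {Equiv.swap 0 1 * Equiv.swap 2 3, Equiv.swap 0 2 * Equiv.swap 1 3}

/-- The excluded cases: up to permutation isomorphism `A` is `K_4`, or `C_i`, or `C_i ⊕ D` for some
permutation group `D`, where `i ∈ {3, 4, 5}`. -/
def IsExcluded {n : ℕ} (A : Subgroup (Equiv.Perm (Fin n))) : Prop :=
  PermIso A kleinPerm ∨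
    ∃ i : ℕ, (i = 3 ∨ i = 4 ∨ i = 5) ∧
      (PermIso A (cyclicPerm i) ∨
        ∃ (m : ℕ) (D : Subgroup (Equiv.Perm (Fin m))), PermIso A (directSum (cyclicPerm i) D))

end BoolSymm

/-! A two-valued function is the indicator of a family of subsets, so `A` lies in BGR(2) as soon as
`A` is exactly the group preserving some family. Such a family is constructed explicitly.

Commutativity and containment in a sum of regular groups both give `RegularOrbits`. Point
stabilizers are then normal, and `A` acts as a subdirect product `H` of finite groups `G i`, by left
multiplication on their disjoint union. On a single group `G`, a left invariant family singles out
the left translations once every preserving permutation that fixes `1` is trivial (`Rigid`). A rigid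
family is constructed for every `G` except the Klein group and the cyclic groups of order 3, 4, 5;
for these there is a family that becomes rigid after one more point `c` is fixed (`Pins`,
`exists_pins`).

`glueFamily` combines the blocks. Initial unions of blocks plus a point keep the blocks apart,
graphs of elements of `H` tie the translations on the blocks together into an element of `H`, and
graphs with an extra point `h i * c i` control the image of `c i`. That image can only be `c i` or
its inverse, and a genuine inversion needs an element of `H` equal to `(c i)⁻¹` at `i` and trivial
elsewhere. In the Klein case `c i` is its own inverse. In the cyclic case `c i` generates, so `H`
would contain the whole factor and a small cyclic summand would split off. A lone Klein block has no
second block to support the extra point, hence the exception `K_4`.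

Conversely, a reflection of a cycle of length 3, 4 or 5 moves each single 0-1 word as some rotation
does, so no function can tell it from the rotations. For `K_4` three values suffice. -/

namespace BoolSymm
open scoped Pointwise

/-! ### Left invariant set families on one group; cyclic groups -/

section Local
variable {G : Type*} [Group G]

theorem edge_of_image_smul_pair {c g h : G} (hc : c ≠ 1) (σ : Equiv.Perm G)
    (H : σ '' (g • ({1, c} : Set G)) = h • ({1, c} : Set G)) :
    σ (g * c) = σ g * c ∨ σ g = σ (g * c) * c := by
  have h1 : σ g ∈ h • ({1, c} : Set G) := by
    rw [← H]; exact ⟨g, ⟨1, by simp, by simp⟩, rfl⟩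
  have h2 : σ (g * c) ∈ h • ({1, c} : Set G) := by
    rw [← H]; exact ⟨g * c, ⟨c, by simp, by simp⟩, rfl⟩
  have hne : σ g ≠ σ (g * c) := fun e => hc (by simpa using σ.injective e)
  rw [Set.mem_smul_set] at h1 h2
  simp only [Set.mem_insert_iff, Set.mem_singleton_iff, smul_eq_mul, exists_eq_or_imp,
    exists_eq_left, mul_one] at h1 h2
  rcases h1 with h1 | h1 <;> rcases h2 with h2 | h2
  · exact absurd (h1.symm.trans h2) hne
  · left; rw [← h1, ← h2]
  · right; rw [← h1, ← h2]
  · exact absurd (h1.symm.trans h2) hne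

/-- A permutation preserving the edges of a cycle is a rotation or a reflection. -/
theorem rotation_or_reflection [Finite G] {c : G} (hc : c * c ≠ 1)
    (hgen : ∀ x, x ∈ Subgroup.zpowers c) (σ : Equiv.Perm G)
    (H : ∀ g, σ (g * c) = σ g * c ∨ σ g = σ (g * c) * c) :
    (∀ g, σ (g * c) = σ g * c) ∨ (∀ g, σ g = σ (g * c) * c) := by
  have hcc : ∀ g : G, g * c * c ≠ g := fun g e => hc (by simpa [mul_assoc] using e)
  have key : ∀ P : G → Prop, (∀ g, P g → P (g * c)) → P 1 → ∀ g, P g := by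
    intro P hP h1 g
    obtain ⟨k, rfl⟩ : g ∈ Submonoid.powers c := mem_powers_iff_mem_zpowers.2 (hgen g)
    induction k with
    | zero => simpa using h1
    | succ k ih => simpa [pow_succ] using hP _ ih
  -- Reversing direction between the edges at `g` and `g * c` would give `σ (g * c * c) = σ g`, so
  -- the direction at `1` propagates along the whole cycle.
  rcases H 1 with h1 | h1
  · refine Or.inl (key _ (fun g hg => ?_) h1)
    rcases H (g * c) with h | h
    · exact h
    · exact absurd (σ.injective (mul_right_cancel (h.symm.trans hg))) (hcc g)
  · refine Or.inr (key _ (fun g hg => ?_) h1)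
    rcases H (g * c) with h | h
    · exact absurd (σ.injective (h.trans hg.symm)) (hcc g)
    · exact h

theorem eq_one_of_comm_generator [Finite G] {c : G} (hgen : ∀ x, x ∈ Subgroup.zpowers c)
    (σ : Equiv.Perm G) (h1 : σ 1 = 1) (H : ∀ g, σ (g * c) = σ g * c) : σ = 1 := by
  ext g
  obtain ⟨k, rfl⟩ : g ∈ Submonoid.powers c := mem_powers_iff_mem_zpowers.2 (hgen g)
  induction k with
  | zero => simpa using h1
  | succ k ih => simp only [pow_succ, H]; simpa using ih

/-- The family of left translates of a set. -/
def translates (B : Set G) : Set (Set G) := Set.range fun g : G => g • B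

theorem smul_mem_translates {B s : Set G} (hs : s ∈ translates B) (g : G) :
    g • s ∈ translates B := by
  obtain ⟨h, rfl⟩ := hs
  exact ⟨g * h, by simp [mul_smul]⟩

theorem self_smul_mem_translates (B : Set G) (g : G) : g • B ∈ translates B := ⟨g, rfl⟩

theorem ncard_smul_set' (g : G) (B : Set G) : (g • B).ncard = B.ncard :=
  Set.ncard_image_of_injective B (MulAction.injective g)

theorem ncard_of_mem_translates {B s : Set G} (hs : s ∈ translates B) : s.ncard = B.ncard := by
  obtain ⟨g, rfl⟩ := hs
  exact ncard_smul_set' g B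

/-- The family `L` and the element `c` are such that `L` is left invariant, has no member with
fewer than two elements, and together with `c` pins down the identity permutation. -/
structure Pins (L : Set (Set G)) (c : G) : Prop where
  smul_mem : ∀ g : G, ∀ s ∈ L, g • s ∈ L
  two_le : ∀ s ∈ L, 2 ≤ s.ncard
  ne_one : 3 ≤ Nat.card G → c ≠ 1
  eq_one : ∀ σ : Equiv.Perm G, (∀ s ∈ L, σ '' s ∈ L) → σ 1 = 1 → σ c = c → σ = 1

/-- Only the identity permutation preserves `L` and fixes `1`. -/
def Rigid (L : Set (Set G)) : Prop :=
  ∀ σ : Equiv.Perm G, (∀ s ∈ L, σ '' s ∈ L) → σ 1 = 1 → σ = 1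

/-- The translates of `{1, c}` are the edges of a cycle. A reflection fixing `1` sends `c` to its
inverse, so fixing `c` as well leaves only the identity. -/
theorem pins_pair_of_generator [Finite G] {c : G} (hc : c * c ≠ 1)
    (hgen : ∀ x, x ∈ Subgroup.zpowers c) : Pins (translates ({1, c} : Set G)) c := by
  have hc1 : c ≠ 1 := fun h => hc (by simp [h])
  refine ⟨fun g s hs => smul_mem_translates hs g, fun s hs => ?_, fun _ => hc1, ?_⟩
  · rw [ncard_of_mem_translates hs, Set.ncard_pair hc1.symm]
  · intro σ hσ h1 hσc
    have hE : ∀ g, σ (g * c) = σ g * c ∨ σ g = σ (g * c) * c := fun g => by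
      obtain ⟨h, hh⟩ := hσ _ (self_smul_mem_translates _ g)
      exact edge_of_image_smul_pair hc1 σ hh.symm
    rcases rotation_or_reflection hc hgen σ hE with h | h
    · exact eq_one_of_comm_generator hgen σ h1 h
    · have := h 1
      rw [one_mul, h1, hσc] at this
      exact absurd this.symm hc

theorem ncard_triple {G : Type*} {a b c : G} (h1 : a ≠ b) (h2 : a ≠ c) (h3 : b ≠ c) :
    ({a, b, c} : Set G).ncard = 3 := by
  rw [Set.ncard_insert_of_notMem (by simp [h1, h2]), Set.ncard_pair h3]

/-- The pairs `{1, c}` leave rotations and reflections; the translates of `{1, c, c ^ 3}` are added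
to break the mirror symmetry. From order 6 on, `{1, c⁻¹, c⁻³}` is not a translate of this triple. -/
theorem exists_rigid_of_cyclic [Finite G] {c : G} (hgen : ∀ x, x ∈ Subgroup.zpowers c)
    (hcard : 6 ≤ Nat.card G) : ∃ L : Set (Set G), Pins L c ∧ Rigid L := by
  have hord : orderOf c = Nat.card G := orderOf_eq_card_of_forall_mem_zpowers hgen
  have hpow : ∀ k, 0 < k → k < 6 → c ^ k ≠ 1 := fun k hk h6 h => by
    have := orderOf_le_of_pow_eq_one hk h
    omega
  have hc1 : c ≠ 1 := by simpa using hpow 1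
  have hc : c * c ≠ 1 := by simpa [pow_two] using hpow 2
  have n1 : ({1, c} : Set G).ncard = 2 := Set.ncard_pair hc1.symm
  have n2 : ({1, c, c ^ 3} : Set G).ncard = 3 :=
    ncard_triple hc1.symm (hpow 3 (by omega) (by omega)).symm (fun h => hc (by
      have : c * 1 = c * (c * c) := by rw [mul_one, ← mul_assoc, ← pow_three']; exact h
      exact (mul_left_cancel this).symm))
  refine ⟨translates ({1, c} : Set G) ∪ translates ({1, c, c ^ 3} : Set G), ?_⟩
  have hR : Rigid (translates ({1, c} : Set G) ∪ translates ({1, c, c ^ 3} : Set G)) := by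
    intro σ hσ h1
    have hA : ∀ g, ∃ h, σ '' (g • ({1, c} : Set G)) = h • ({1, c} : Set G) := fun g => by
      rcases hσ _ (Or.inl (self_smul_mem_translates _ g)) with ⟨h, hh⟩ | h
      · exact ⟨h, hh.symm⟩
      · have := ncard_of_mem_translates h
        rw [Set.ncard_image_of_injective _ σ.injective, ncard_smul_set', n1, n2] at this
        omega
    have hB : ∀ g, ∃ h, σ '' (g • ({1, c, c ^ 3} : Set G)) = h • ({1, c, c ^ 3} : Set G) :=
      fun g => by
      rcases hσ _ (Or.inr (self_smul_mem_translates _ g)) with h | ⟨h, hh⟩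
      · have := ncard_of_mem_translates h
        rw [Set.ncard_image_of_injective _ σ.injective, ncard_smul_set', n1, n2] at this
        omega
      · exact ⟨h, hh.symm⟩
    have hE : ∀ g, σ (g * c) = σ g * c ∨ σ g = σ (g * c) * c := fun g => by
      obtain ⟨h, hh⟩ := hA g
      exact edge_of_image_smul_pair hc1 σ hh
    rcases rotation_or_reflection hc hgen σ hE with h | h
    · exact eq_one_of_comm_generator hgen σ h1 h
    · exfalso
      have e1 : σ c = c⁻¹ := by
        have := h 1
        rw [one_mul, h1] at this
        exact eq_inv_of_mul_eq_one_left this.symm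
      have e2 : σ (c ^ 2) = (c ^ 2)⁻¹ := by
        have := h c
        rw [e1, ← pow_two] at this
        rw [eq_mul_inv_of_mul_eq this.symm]; simp [pow_two]
      have e3 : σ (c ^ 3) = (c ^ 3)⁻¹ := by
        have := h (c ^ 2)
        rw [e2, ← pow_succ] at this
        rw [eq_mul_inv_of_mul_eq this.symm, ← mul_inv_rev, ← pow_succ']
      obtain ⟨t, ht⟩ := hB 1
      simp only [one_smul, Set.image_insert_eq, Set.image_singleton, h1, e1, e3] at ht
      have m1 : t ∈ ({1, c⁻¹, (c ^ 3)⁻¹} : Set G) := by rw [ht]; exact ⟨1, by simp, by simp⟩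
      have m2 : t * c ∈ ({1, c⁻¹, (c ^ 3)⁻¹} : Set G) := by rw [ht]; exact ⟨c, by simp, by simp⟩
      have m3 : t * c ^ 3 ∈ ({1, c⁻¹, (c ^ 3)⁻¹} : Set G) := by
        rw [ht]; exact ⟨c ^ 3, by simp, by simp⟩
      have k1 := hpow 1 (by omega) (by omega)
      have k2 := hpow 2 (by omega) (by omega)
      have k3 := hpow 3 (by omega) (by omega)
      have k4 := hpow 4 (by omega) (by omega)
      have k5 := hpow 5 (by omega) (by omega)
      simp only [Set.mem_insert_iff, Set.mem_singleton_iff] at m1 m2 m3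
      -- Every coincidence to be refuted below equates powers of `c` whose exponents differ by 1 to
      -- 5, which order at least 6 forbids.
      have z : ∀ k : ℤ, c ^ k = 1 → k.natAbs ∈ ({1, 2, 3, 4, 5} : Finset ℕ) → False := by
        intro k hk hm
        have : c ^ k.natAbs = 1 := by
          rcases Int.natAbs_eq k with h | h
          · rw [h] at hk; simpa using hk
          · rw [h] at hk; simpa using hk
        simp only [Finset.mem_insert, Finset.mem_singleton] at hm
        rcases hm with hm | hm | hm | hm | hm <;> rw [hm] at this <;> contradiction
      have zz : ∀ a b : ℤ, c ^ a = c ^ b → (a - b).natAbs ∈ ({1, 2, 3, 4, 5} : Finset ℕ) →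
          False := fun a b hab => z _ (by rw [zpow_sub, hab, mul_inv_cancel])
      rcases m1 with rfl | rfl | rfl
      · rcases m2 with m | m | m
        · exact zz 1 0 (by simpa using m) (by decide)
        · exact zz 1 (-1) (by simpa using m) (by decide)
        · exact zz 1 (-3) (by simpa [zpow_neg, zpow_ofNat] using m) (by decide)
      · rcases m3 with m | m | m
        · exact zz (-1 + 3) 0 (by rw [zpow_add]; simpa [zpow_neg, zpow_ofNat] using m) (by decide)
        · exact zz (-1 + 3) (-1) (by rw [zpow_add]; simpa [zpow_neg, zpow_ofNat] using m) (by decide)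
        · exact zz (-1 + 3) (-3) (by rw [zpow_add]; simpa [zpow_neg, zpow_ofNat] using m) (by decide)
      · rcases m2 with m | m | m
        · exact zz (-3 + 1) 0 (by rw [zpow_add]; simpa [zpow_neg, zpow_ofNat] using m) (by decide)
        · exact zz (-3 + 1) (-1) (by rw [zpow_add]; simpa [zpow_neg, zpow_ofNat] using m) (by decide)
        · exact zz (-3 + 1) (-3) (by rw [zpow_add]; simpa [zpow_neg, zpow_ofNat] using m) (by decide)
  refine ⟨⟨?_, ?_, fun _ => hc1, fun σ hσ h1 _ => hR σ hσ h1⟩, hR⟩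
  · rintro g s (hs | hs)
    · exact Or.inl (smul_mem_translates hs g)
    · exact Or.inr (smul_mem_translates hs g)
  · rintro s (hs | hs) <;> rw [ncard_of_mem_translates hs] <;> omega

end Local

/-! ### Rigid families on noncyclic groups -/

section Chain
variable {G : Type*} [Group G]

/-- The pair `{1, u}` together with the first `k` terms of the sequence `f`. -/
def chainSet (u : G) (f : ℕ → G) (k : ℕ) : Set G := {1, u} ∪ f '' Set.Iio k

/-- The translates of the chain sets up to index `N` and of the complement of `{1, f 0}`. -/
def chainFamily (u : G) (f : ℕ → G) (N : ℕ) : Set (Set G) :=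
  {s | ∃ k ≤ N, s ∈ translates (chainSet u f k)} ∪ translates ({1, f 0} : Set G)ᶜ

/-- The sequence `f` lists, up to index `N`, representatives of the nontrivial left cosets of the
group generated by `u`. -/
structure CosetSeq (u : G) (f : ℕ → G) (N : ℕ) : Prop where
  ne_one : u ≠ 1
  notMem : ∀ k < N, f k ∉ Subgroup.zpowers u
  inj : ∀ i < N, ∀ k < N, (f i)⁻¹ * f k ∈ Subgroup.zpowers u → i = k
  cover : ∀ g, g ∈ Subgroup.zpowers u ∨ ∃ k < N, (f k)⁻¹ * g ∈ Subgroup.zpowers u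

variable {u : G} {f : ℕ → G} {N : ℕ}

theorem mem_zpowers_of_mem_pair {x : G} (hx : x ∈ ({1, u} : Set G)) : x ∈ Subgroup.zpowers u := by
  rcases hx with rfl | rfl
  · exact one_mem _
  · exact Subgroup.mem_zpowers _

theorem CosetSeq.injOn (C : CosetSeq u f N) : ∀ i < N, ∀ k < N, f i = f k → i = k :=
  fun i hi k hk h => C.inj i hi k hk (by simp [h])

theorem CosetSeq.ncard_chainSet [Finite G] (C : CosetSeq u f N) {k : ℕ} (hk : k ≤ N) :
    (chainSet u f k).ncard = 2 + k := by
  rw [chainSet, Set.ncard_union_eq, Set.ncard_pair C.ne_one.symm, Set.InjOn.ncard_image]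
  · simp [Set.ncard_eq_toFinset_card']
  · intro i hi j hj h
    exact C.injOn i (lt_of_lt_of_le hi hk) j (lt_of_lt_of_le hj hk) h
  · rw [Set.disjoint_left]
    rintro x hx ⟨i, hi, rfl⟩
    exact C.notMem i (lt_of_lt_of_le hi hk) (mem_zpowers_of_mem_pair hx)

theorem mem_smul_pair {x y a b : G} : y ∈ x • ({a, b} : Set G) ↔ y = x * a ∨ y = x * b := by
  simp [Set.mem_smul_set, eq_comm]

/-- The points `x` and `x * u` share a left coset of `⟨u⟩`, while a chain set has at most one point
in every nontrivial coset and only `1, u` in the trivial one. -/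
theorem CosetSeq.smul_pair_eq [Finite G] (C : CosetSeq u f N) {k : ℕ} (hk : k ≤ N) {x : G}
    (hx : x • ({1, u} : Set G) ⊆ chainSet u f k) : x • ({1, u} : Set G) = {1, u} := by
  have hu := Subgroup.mem_zpowers u
  have h1 : x ∈ chainSet u f k := hx (mem_smul_pair.2 (by simp))
  have h2 : x * u ∈ chainSet u f k := hx (mem_smul_pair.2 (by simp))
  have hxu : x ∈ ({1, u} : Set G) ∧ x * u ∈ ({1, u} : Set G) := by
    rcases h1 with h1 | ⟨i, hi, rfl⟩
    · refine ⟨h1, h2.resolve_right ?_⟩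
      rintro ⟨j, hj, hj'⟩
      refine C.notMem j (lt_of_lt_of_le hj hk) ?_
      rw [hj']
      exact mul_mem (mem_zpowers_of_mem_pair h1) hu
    · exfalso
      rcases h2 with h2 | ⟨j, hj, hj'⟩
      · refine C.notMem i (lt_of_lt_of_le hi hk) ?_
        exact (Subgroup.mul_mem_cancel_right _ hu).1 (mem_zpowers_of_mem_pair h2)
      · have := C.inj i (lt_of_lt_of_le hi hk) j (lt_of_lt_of_le hj hk) (by rw [hj']; simp)
        subst this
        exact C.ne_one (by simpa using hj')
  refine Set.eq_of_subset_of_ncard_le ?_ (ncard_smul_set' _ _).ge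
  intro y hy
  rcases mem_smul_pair.1 hy with rfl | rfl
  · simpa using hxu.1
  · exact hxu.2

theorem CosetSeq.rigid [Finite G] (C : CosetSeq u f N) (hN : 0 < N) (hcard : N + 4 < Nat.card G)
    (hu : u * u ≠ 1 ∨ ∀ x y : G, x * y = y * x) (h0 : f 0 * f 0 ≠ u) :
    Rigid (chainFamily u f N) := by
  intro σ hσ hσ1
  have nc : ∀ {k}, k ≤ N → (chainSet u f k).ncard = 2 + k := C.ncard_chainSet
  have hf01 : (1 : G) ≠ f 0 := fun h => C.notMem 0 hN (h ▸ one_mem _)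
  have ncc : ({1, f 0} : Set G)ᶜ.ncard = Nat.card G - 2 := by
    rw [Set.ncard_compl, Set.ncard_pair hf01]
  -- The sizes `2, …, N + 2` and `|G| - 2` are all different, so `σ` respects each kind of translate
  -- separately. Using the complement keeps the pair `{1, f 0}` from being confused with `{1, u}`.
  have hchain : ∀ g : G, ∀ k ≤ N, ∃ h : G, σ '' (g • chainSet u f k) = h • chainSet u f k := by
    intro g k hk
    have e : (σ '' (g • chainSet u f k)).ncard = 2 + k := by
      rw [Set.ncard_image_of_injective _ σ.injective, ncard_smul_set', nc hk]
    rcases hσ _ (Or.inl ⟨k, hk, self_smul_mem_translates _ g⟩) with ⟨l, hl, h⟩ | h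
    · have := ncard_of_mem_translates h
      rw [e, nc hl] at this
      obtain rfl : k = l := by omega
      obtain ⟨h', hh⟩ := h
      exact ⟨h', hh.symm⟩
    · have := ncard_of_mem_translates h
      rw [e, ncc] at this
      omega
  have hcompl : ∀ g : G, ∃ h : G, σ '' (g • ({1, f 0} : Set G)) = h • ({1, f 0} : Set G) := by
    intro g
    have e : (σ '' (g • ({1, f 0} : Set G)ᶜ)).ncard = Nat.card G - 2 := by
      rw [Set.ncard_image_of_injective _ σ.injective, ncard_smul_set', ncc]
    rcases hσ _ (Or.inr (self_smul_mem_translates _ g)) with ⟨l, hl, h⟩ | ⟨h, hh⟩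
    · have := ncard_of_mem_translates h
      rw [e, nc hl] at this
      omega
    · refine ⟨h, ?_⟩
      dsimp only at hh
      rw [Set.smul_set_compl, Set.smul_set_compl, Set.image_compl_eq σ.bijective] at hh
      exact (compl_injective hh).symm
  have hT : chainSet u f 0 = {1, u} := by simp [chainSet]
  have hrot : ∀ g, σ (g * u) = σ g * u ∧ ∀ k < N, σ (g * f k) = σ g * f k := by
    intro g
    choose! t ht using hchain g
    have htT : ∀ k ≤ N, σ '' (g • ({1, u} : Set G)) = t k • ({1, u} : Set G) := by
      intro k hk
      have h1 : ((t k)⁻¹ * t 0) • ({1, u} : Set G) ⊆ chainSet u f k := by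
        rw [mul_smul, ← Set.subset_smul_set_iff, ← ht k hk, ← hT, ← ht 0 (Nat.zero_le _), hT]
        exact Set.image_mono (Set.smul_set_mono Set.subset_union_left)
      have h2 := C.smul_pair_eq hk h1
      rw [mul_smul, inv_smul_eq_iff] at h2
      rw [← h2, ← hT, ht 0 (Nat.zero_le _)]
    have htW : ∀ k ≤ N, σ '' (g • (f '' Set.Iio k)) = t k • (f '' Set.Iio k) := by
      intro k hk
      have hd : f '' Set.Iio k = chainSet u f k \ {1, u} := by
        rw [chainSet, Set.union_sdiff_left, eq_comm, sdiff_eq_left, Set.disjoint_left]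
        rintro x ⟨i, hi, rfl⟩ hx
        exact C.notMem i (lt_of_lt_of_le hi hk) (mem_zpowers_of_mem_pair hx)
      rw [hd, Set.smul_set_sdiff, Set.smul_set_sdiff, Set.image_sdiff σ.injective, ht k hk,
        htT k hk]
    have hw0 : σ (g * f 0) = t 1 * f 0 := by
      have := htW 1 hN
      have e : Set.Iio (1 : ℕ) = {0} := by ext; simp
      simpa [e] using this
    -- The pairs `t k • {1, u}` all coincide, so only `t 1 = t k * u` must be excluded. If `u * u ≠
    -- 1`, the pairs would differ. In the commutative case the image of `g * f 0` would force some
    -- `f i = u * f 0`, a second representative of the coset of `f 0`.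
    have ht1 : ∀ k, 0 < k → k ≤ N → t k = t 1 := by
      intro k hk0 hk
      have h1 : t 1 ∈ t k • ({1, u} : Set G) := by
        rw [← htT k hk, htT 1 hN, mem_smul_pair]; simp
      rcases mem_smul_pair.1 h1 with h1 | h1
      · simpa using h1.symm
      · exfalso
        rcases hu with hu | hu
        · have h2 : t 1 * u ∈ t k • ({1, u} : Set G) := by
            rw [← htT k hk, htT 1 hN, mem_smul_pair]; simp
          rw [h1, mem_smul_pair] at h2
          rcases h2 with h2 | h2
          · exact hu (by simpa [mul_assoc] using h2)
          · exact C.ne_one (by simpa using h2)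
        · have h2 : σ (g * f 0) ∈ t k • (f '' Set.Iio k) := by
            rw [← htW k hk]
            exact ⟨_, ⟨f 0, ⟨0, hk0, rfl⟩, rfl⟩, rfl⟩
          obtain ⟨_, ⟨i, hi, rfl⟩, h2⟩ := h2
          replace h2 : t k * f i = t k * u * f 0 := by rw [← h1, ← hw0]; exact h2
          rw [mul_assoc, mul_right_inj] at h2
          have hi' := C.inj 0 hN i (lt_of_lt_of_le hi hk) (by
            rw [h2, hu u, inv_mul_cancel_left]; exact Subgroup.mem_zpowers u)
          subst hi'
          exact C.ne_one (by simpa using h2)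
    -- `f k` is the only point by which the chain grows at stage `k`.
    have hwk : ∀ k < N, σ (g * f k) = t 1 * f k := by
      intro k hk
      rcases Nat.eq_zero_or_pos k with rfl | hk0
      · exact hw0
      have h1 : σ (g * f k) ∈ t 1 • (f '' Set.Iio (k + 1)) := by
        rw [← ht1 (k + 1) (by omega) hk, ← htW (k + 1) hk]
        exact ⟨_, ⟨f k, ⟨k, by simp, rfl⟩, rfl⟩, rfl⟩
      obtain ⟨_, ⟨i, hi, rfl⟩, h1⟩ := h1
      rcases Nat.lt_succ_iff_lt_or_eq.1 hi with hi | rfl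
      · exfalso
        have h2 : σ (g * f k) ∈ σ '' (g • (f '' Set.Iio k)) := by
          rw [htW k hk.le, ht1 k hk0 hk.le, ← h1]
          exact ⟨_, ⟨i, hi, rfl⟩, rfl⟩
        obtain ⟨_, ⟨_, ⟨j, hj, rfl⟩, rfl⟩, h2⟩ := h2
        have h3 : f j = f k := by simpa using h2
        have := C.injOn j (lt_trans hj hk) k hk h3
        exact (ne_of_lt hj) this
      · exact h1.symm
    have hσg : σ g ∈ t 1 • ({1, u} : Set G) := by
      rw [← htT 1 hN]; exact ⟨g, mem_smul_pair.2 (by simp), rfl⟩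
    have hσgu : σ (g * u) ∈ t 1 • ({1, u} : Set G) := by
      rw [← htT 1 hN]; exact ⟨g * u, mem_smul_pair.2 (by simp), rfl⟩
    have hne : σ g ≠ σ (g * u) := fun e => C.ne_one (by simpa using σ.injective e)
    -- The chain leaves open that `σ` swaps the two points of the pair. Then the translates of `{1,
    -- f 0}` would give `u = 1` or `f 0 * f 0 = u`.
    have ht' : t 1 = σ g := by
      rcases mem_smul_pair.1 hσg with h | h
      · simpa using h.symm
      · exfalso
        obtain ⟨h', hh⟩ := hcompl g
        rcases edge_of_image_smul_pair hf01.symm σ hh with e | e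
        · rw [hw0, h] at e
          exact C.ne_one (by simpa using e)
        · rw [hw0, h, mul_assoc, mul_right_inj] at e
          exact h0 e.symm
    refine ⟨?_, fun k hk => ht' ▸ hwk k hk⟩
    rcases mem_smul_pair.1 hσgu with h | h
    · exact absurd (by rw [h, ht', mul_one]) hne
    · rw [h, ht']
  -- Right multiplications commuting with `σ` form a subgroup; it contains `u` and all coset
  -- representatives, hence everything.
  let S : Subgroup G :=
    { carrier := {x | ∀ g, σ (g * x) = σ g * x}
      one_mem' := fun g => by simp
      mul_mem' := fun {a b} ha hb g => by rw [← mul_assoc, hb, ha, mul_assoc]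
      inv_mem' := fun {a} ha g => by
        have := ha (g * a⁻¹)
        rw [inv_mul_cancel_right] at this
        rw [this, mul_inv_cancel_right] }
  have hUS : Subgroup.zpowers u ≤ S := by
    rw [Subgroup.zpowers_le]
    exact fun g => (hrot g).1
  have hS : ∀ x, x ∈ S := by
    intro x
    rcases C.cover x with hx | ⟨k, hk, hx⟩
    · exact hUS hx
    · have h1 : f k ∈ S := fun g => (hrot g).2 k hk
      simpa using mul_mem h1 (hUS hx)
  ext x
  have := hS x 1
  rw [one_mul, hσ1, one_mul] at this
  simpa using this

theorem CosetSeq.pins [Finite G] (C : CosetSeq u f N) (hN : 0 < N) (hcard : N + 4 < Nat.card G)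
    (hu : u * u ≠ 1 ∨ ∀ x y : G, x * y = y * x) (h0 : f 0 * f 0 ≠ u) :
    Pins (chainFamily u f N) u := by
  refine ⟨?_, ?_, fun _ => C.ne_one, fun σ h1 h2 _ => C.rigid hN hcard hu h0 σ h1 h2⟩
  · rintro g s (⟨k, hk, hs⟩ | hs)
    · exact Or.inl ⟨k, hk, smul_mem_translates hs g⟩
    · exact Or.inr (smul_mem_translates hs g)
  · rintro s (⟨k, hk, hs⟩ | hs)
    · rw [ncard_of_mem_translates hs, C.ncard_chainSet hk]; omega
    · have hf01 : (1 : G) ≠ f 0 := fun h => C.notMem 0 hN (h ▸ one_mem _)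
      rw [ncard_of_mem_translates hs, Set.ncard_compl, Set.ncard_pair hf01]
      omega

/-- Coset representatives with a prescribed first term. -/
theorem exists_cosetSeq [Finite G] {w : G} (hu : u ≠ 1) (hw : w ∉ Subgroup.zpowers u) :
    ∃ (f : ℕ → G) (N : ℕ), CosetSeq u f N ∧ f 0 = w ∧ 0 < N ∧
      Nat.card G = orderOf u * (N + 1) := by
  classical
  set U := Subgroup.zpowers u with hU
  have : Fintype (G ⧸ U) := Fintype.ofFinite _
  let Q : Finset (G ⧸ U) := (Finset.univ.erase ((1 : G) : G ⧸ U)).erase (w : G ⧸ U)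
  have hw1 : (w : G ⧸ U) ≠ ((1 : G) : G ⧸ U) := fun h => hw (by
    have := QuotientGroup.eq.1 h.symm
    simpa using this)
  let l : List G := w :: Q.toList.map Quotient.out
  have hmap : l.map (QuotientGroup.mk : G → G ⧸ U) = (w : G ⧸ U) :: Q.toList := by
    simp [l, List.map_map, Function.comp_def]
  have hnd : (l.map (QuotientGroup.mk : G → G ⧸ U)).Nodup := by
    rw [hmap, List.nodup_cons]
    exact ⟨by simp [Q], Q.nodup_toList⟩
  have hmem : ∀ q : G ⧸ U, q ∈ l.map (QuotientGroup.mk : G → G ⧸ U) ↔ q ≠ ((1 : G) : G ⧸ U) := by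
    intro q
    rw [hmap]
    by_cases h : q = (w : G ⧸ U)
    · simp [h, hw1]
    · simp [Q, h]
  have hlen : l.length + 1 = Nat.card (G ⧸ U) := by
    have h1 : (l.map (QuotientGroup.mk : G → G ⧸ U)).toFinset =
        Finset.univ.erase ((1 : G) : G ⧸ U) := by
      ext q; rw [List.mem_toFinset, hmem]; simp
    have h2 := List.toFinset_card_of_nodup hnd
    rw [h1, List.length_map, Finset.card_erase_of_mem (Finset.mem_univ _), Finset.card_univ] at h2
    have : 0 < Fintype.card (G ⧸ U) := Fintype.card_pos_iff.2 ⟨((1 : G) : G ⧸ U)⟩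
    rw [Nat.card_eq_fintype_card]
    omega
  -- The default value `1` occurs only beyond the range `k < N` that `CosetSeq` inspects.
  refine ⟨fun k => l.getD k 1, l.length, ⟨hu, ?_, ?_, ?_⟩, by simp [l], by simp [l], ?_⟩
  · intro k hk h
    have h1 : (QuotientGroup.mk (l[k]) : G ⧸ U) ∈ l.map (QuotientGroup.mk : G → G ⧸ U) :=
      List.mem_map_of_mem (List.getElem_mem hk)
    rw [hmem] at h1
    refine h1 (Eq.symm ?_)
    rw [QuotientGroup.eq]
    simpa [hk] using h
  · intro i hi k hk h
    have h1 : (QuotientGroup.mk (l[i]) : G ⧸ U) = QuotientGroup.mk (l[k]) := by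
      rw [QuotientGroup.eq]; simpa [hi, hk] using h
    have h2 : (l.map (QuotientGroup.mk : G → G ⧸ U))[i]'(by simpa using hi) =
      (l.map (QuotientGroup.mk : G → G ⧸ U))[k]'(by simpa using hk) := by simpa using h1
    exact (hnd.getElem_inj_iff).1 h2
  · intro g
    by_cases hg : g ∈ U
    · exact Or.inl hg
    · right
      have h1 : (g : G ⧸ U) ∈ l.map (QuotientGroup.mk : G → G ⧸ U) := by
        rw [hmem]
        intro h
        have := QuotientGroup.eq.1 h.symm
        exact hg (by simpa using this)
      obtain ⟨x, hx, hxg⟩ := List.mem_map.1 h1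
      obtain ⟨k, hk, rfl⟩ := List.mem_iff_getElem.1 hx
      exact ⟨k, hk, by simpa [hk] using QuotientGroup.eq.1 hxg⟩
  · rw [hlen, ← Nat.card_zpowers u, mul_comm]
    exact Subgroup.card_eq_card_quotient_mul_card_subgroup U

/-- If some `u` is not an involution or `1`, it is used; otherwise the group has exponent 2, hence
is commutative, and any `u ≠ 1` serves. Either way `CosetSeq.rigid` applies. -/
theorem exists_rigid_of_not_isCyclic [Finite G] (hG : ¬ IsCyclic G) (hcard : 6 ≤ Nat.card G) :
    ∃ (L : Set (Set G)) (c : G), Pins L c ∧ Rigid L := by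
  have hU : ∀ u : G, ∃ w, w ∉ Subgroup.zpowers u := by
    intro u
    by_contra! h
    exact hG ⟨u, h⟩
  by_cases hex : ∃ u : G, u * u ≠ 1
  · obtain ⟨u, hu⟩ := hex
    have hu1 : u ≠ 1 := fun h => hu (by simp [h])
    obtain ⟨w, hw, hwu⟩ : ∃ w, w ∉ Subgroup.zpowers u ∧ w * w ≠ u := by
      obtain ⟨w, hw⟩ := hU u
      by_cases h : w * w = u
      -- Since `u = w * w` commutes with `w`, the square of `w * u` is `u ^ 3`, which differs from
      -- `u`.
      · refine ⟨w * u, fun h' => hw ((Subgroup.mul_mem_cancel_right _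
          (Subgroup.mem_zpowers u)).1 h'), fun h' => hu ?_⟩
        have e : w * u * (w * u) = u * (u * u) := by rw [← h]; group
        rw [e] at h'
        simpa using h'
      · exact ⟨w, hw, h⟩
    obtain ⟨f, N, C, rfl, hN, hc⟩ := exists_cosetSeq hu1 hw
    have ho : 3 ≤ orderOf u := by
      have h1 : orderOf u ≠ 1 := fun h => hu1 (orderOf_eq_one_iff.1 h)
      have h2 : orderOf u ≠ 2 := fun h => hu (by rw [← pow_two, ← h, pow_orderOf_eq_one])
      have := orderOf_pos u
      omega
    have hlt : N + 4 < Nat.card G := by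
      have := Nat.mul_le_mul_right (N + 1) ho
      omega
    exact ⟨_, u, C.pins hN hlt (Or.inl hu) hwu, C.rigid hN hlt (Or.inl hu) hwu⟩
  · push Not at hex
    have hcomm : ∀ x y : G, x * y = y * x := by
      intro x y
      have h := hex (x * y)
      have hx := eq_inv_of_mul_eq_one_left (hex x)
      have hy := eq_inv_of_mul_eq_one_left (hex y)
      rw [eq_inv_of_mul_eq_one_left h, mul_inv_rev, ← hx, ← hy]
    have : Nontrivial G := Finite.one_lt_card_iff_nontrivial.1 (by omega)
    obtain ⟨u, hu1⟩ := exists_ne (1 : G)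
    obtain ⟨w, hw⟩ := hU u
    have hwu : w * w ≠ u := by rw [hex]; exact hu1.symm
    obtain ⟨f, N, C, rfl, hN, hc⟩ := exists_cosetSeq hu1 hw
    have ho : orderOf u = 2 := orderOf_eq_prime (by rw [pow_two, hex]) hu1
    -- With `|G| = 2 * (N + 1)` this fails only at order 6, where Cauchy's theorem gives an element
    -- of order 3.
    have hlt : N + 4 < Nat.card G := by
      rw [ho] at hc
      by_contra hcon
      have h6 : Nat.card G = 6 := by omega
      have : Fact (Nat.Prime 3) := ⟨Nat.prime_three⟩
      obtain ⟨x, hx⟩ := exists_prime_orderOf_dvd_card' 3 (G := G) (by rw [h6]; decide)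
      have : orderOf x ∣ 2 := orderOf_dvd_of_pow_eq_one (by rw [pow_two, hex])
      rw [hx] at this
      revert this; decide
    exact ⟨_, u, C.pins hN hlt (Or.inr hcomm) hwu, C.rigid hN hlt (Or.inr hcomm) hwu⟩

end Chain

/-! ### Groups of order below 6 -/

section Small
variable {G : Type*} [Group G]

theorem klein_of_not_isCyclic [Finite G] (hG : ¬ IsCyclic G) (hcard : Nat.card G = 4) :
    (∀ x : G, x * x = 1) ∧ ∃ a b : G, a ≠ 1 ∧ b ≠ 1 ∧ a ≠ b ∧ a * b = b * a ∧
      ∀ x, x = 1 ∨ x = a ∨ x = b ∨ x = a * b := by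
  have hsq : ∀ x : G, x * x = 1 := by
    intro x
    have h1 : orderOf x ∣ 2 ^ 2 := by
      have := orderOf_dvd_natCard x
      rwa [hcard] at this
    obtain ⟨k, hk, h⟩ := (Nat.dvd_prime_pow Nat.prime_two).1 h1
    have hk2 : k ≠ 2 := fun h2 => hG (isCyclic_of_orderOf_eq_card x (by rw [h, h2, hcard]; norm_num))
    rw [← pow_two]
    refine orderOf_dvd_iff_pow_eq_one.1 ?_
    rw [h]
    exact pow_dvd_pow 2 (show k ≤ 1 by omega)
  have hinv : ∀ x : G, x⁻¹ = x := fun x => inv_eq_of_mul_eq_one_left (hsq x)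
  have hcomm : ∀ x y : G, x * y = y * x := fun x y => by
    rw [← hinv (x * y), mul_inv_rev, hinv, hinv]
  have : Nontrivial G := Finite.one_lt_card_iff_nontrivial.1 (by omega)
  obtain ⟨a, ha⟩ := exists_ne (1 : G)
  have h2 : ∃ b, b ∉ ({1, a} : Set G) := by
    by_contra! h
    have h3 : ({1, a} : Set G) = Set.univ := Set.eq_univ_of_forall h
    have h4 := Set.ncard_pair ha.symm
    rw [h3, Set.ncard_univ] at h4
    omega
  obtain ⟨b, hb⟩ := h2
  simp only [Set.mem_insert_iff, Set.mem_singleton_iff, not_or] at hb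
  refine ⟨hsq, a, b, ha, hb.1, fun h => hb.2 h.symm, hcomm a b, fun x => ?_⟩
  have h5 : ({1, a, b, a * b} : Set G) = Set.univ := by
    refine Set.eq_of_subset_of_ncard_le (Set.subset_univ _) ?_
    rw [Set.ncard_univ, hcard, Set.ncard_insert_of_notMem,
      ncard_triple (Ne.symm hb.2) (by simpa using hb.1) (by simpa using ha)]
    simp only [Set.mem_insert_iff, Set.mem_singleton_iff, not_or]
    refine ⟨ha.symm, Ne.symm hb.1, fun h => hb.2 ?_⟩
    rw [← hinv a]
    exact eq_inv_of_mul_eq_one_right h.symm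
  have h6 : x ∈ ({1, a, b, a * b} : Set G) := h5 ▸ Set.mem_univ x
  simpa using h6

/-- As `a * a = 1`, either orientation of an edge `{g, g * a}` yields that `σ` commutes with right
multiplication by `a`; fixing `1` and `b` then fixes `a` and `a * b`. -/
theorem exists_pins_of_klein [Finite G] (hG : ¬ IsCyclic G) (hcard : Nat.card G = 4) :
    ∃ (L : Set (Set G)) (c : G), Pins L c ∧ c * c = 1 := by
  obtain ⟨hsq, a, b, ha, hb, -, hab, hall⟩ := klein_of_not_isCyclic hG hcard
  refine ⟨translates {1, a}, b, ⟨fun g s hs => smul_mem_translates hs g, fun s hs => ?_,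
    fun _ => hb, ?_⟩, hsq b⟩
  · rw [ncard_of_mem_translates hs, Set.ncard_pair ha.symm]
  · intro σ hσ h1 hσb
    have hE : ∀ g, σ (g * a) = σ g * a := fun g => by
      obtain ⟨h, hh⟩ := hσ _ (self_smul_mem_translates _ g)
      rcases edge_of_image_smul_pair ha σ hh.symm with e | e
      · exact e
      · rw [e, mul_assoc, hsq, mul_one]
    ext x
    have e1 := hE 1
    have e2 := hE b
    rw [one_mul, h1, one_mul] at e1
    rw [hσb, ← hab] at e2
    rcases hall x with rfl | rfl | rfl | rfl <;> simpa

theorem eq_one_of_card_le_two [Finite G] (hcard : Nat.card G ≤ 2) (σ : Equiv.Perm G)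
    (h1 : σ 1 = 1) : σ = 1 := by
  ext x
  by_contra hx
  have hx1 : x ≠ 1 := by rintro rfl; exact hx (by simpa using h1)
  have hσ1 : σ x ≠ 1 := fun h => hx1 (σ.injective (h.trans h1.symm))
  have h3 := ncard_triple hx1.symm hσ1.symm (Ne.symm hx : x ≠ σ x)
  have h4 := Set.ncard_le_card ({1, x, σ x} : Set G)
  omega

theorem exists_pins [Finite G] : ∃ (L : Set (Set G)) (c : G), Pins L c ∧
    (Rigid L ∨ (Nat.card G = 4 ∧ ¬ IsCyclic G ∧ c * c = 1) ∨
      ((∀ x, x ∈ Subgroup.zpowers c) ∧ (Nat.card G = 3 ∨ Nat.card G = 4 ∨ Nat.card G = 5))) := by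
  rcases le_or_gt (Nat.card G) 2 with h2 | h2
  · have hr : ∀ σ : Equiv.Perm G, σ 1 = 1 → σ = 1 := eq_one_of_card_le_two h2
    exact ⟨∅, 1, ⟨by simp, by simp, fun h => absurd h (by omega), fun σ _ h _ => hr σ h⟩,
      Or.inl fun σ _ h => hr σ h⟩
  rcases lt_or_ge (Nat.card G) 6 with h6 | h6
  · by_cases hG : IsCyclic G
    · obtain ⟨c, hc⟩ := hG.exists_generator
      have hord : orderOf c = Nat.card G := orderOf_eq_card_of_forall_mem_zpowers hc
      have hcc : c * c ≠ 1 := fun h => by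
        have := orderOf_le_of_pow_eq_one (x := c) (n := 2) (by omega) (by rw [pow_two, h])
        omega
      exact ⟨_, c, pins_pair_of_generator hcc hc, Or.inr (Or.inr ⟨hc, by omega⟩)⟩
    · have h4 : Nat.card G = 4 := by
        by_contra h4
        have h35 : Nat.card G = 3 ∨ Nat.card G = 5 := by omega
        rcases h35 with h | h
        · have : Fact (Nat.Prime 3) := ⟨by norm_num⟩
          exact hG (isCyclic_of_prime_card h)
        · have : Fact (Nat.Prime 5) := ⟨by norm_num⟩
          exact hG (isCyclic_of_prime_card h)
      obtain ⟨L, c, hL, hc⟩ := exists_pins_of_klein hG h4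
      exact ⟨L, c, hL, Or.inr (Or.inl ⟨h4, hG, hc⟩)⟩
  · by_cases hG : IsCyclic G
    · obtain ⟨c, hc⟩ := hG.exists_generator
      obtain ⟨L, hL, hR⟩ := exists_rigid_of_cyclic hc h6
      exact ⟨L, c, hL, Or.inl hR⟩
    · obtain ⟨L, c, hL, hR⟩ := exists_rigid_of_not_isCyclic hG h6
      exact ⟨L, c, hL, Or.inl hR⟩

end Small

/-! ### Gluing the families of the blocks -/

section Glue

/-- A permutation of a disjoint union preserving all blocks acts on each of them. -/
theorem exists_perm_of_fst_eq {ι : Type*} {X : ι → Type*} [∀ i, Finite (X i)]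
    {τ : Equiv.Perm (Σ i, X i)} (hτ : ∀ x, (τ x).1 = x.1) :
    ∃ σ : ∀ i, Equiv.Perm (X i), ∀ i g, τ ⟨i, g⟩ = ⟨i, σ i g⟩ := by
  have h1 : ∀ i (g : X i), ∃ g' : X i, τ ⟨i, g⟩ = ⟨i, g'⟩ := by
    intro i g
    have := hτ ⟨i, g⟩
    rcases h : τ ⟨i, g⟩ with ⟨j, g'⟩
    rw [h] at this
    obtain rfl : j = i := this
    exact ⟨g', rfl⟩
  choose f hf using h1
  have hinj : ∀ i, Function.Injective (f i) := by
    intro i a b hab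
    have : τ ⟨i, a⟩ = τ ⟨i, b⟩ := by rw [hf, hf, hab]
    simpa using τ.injective this
  exact ⟨fun i => Equiv.ofBijective (f i) (Finite.injective_iff_bijective.1 (hinj i)), hf⟩

variable {ι : Type*} {G : ι → Type*} [∀ i, Group (G i)]

/-- The element `h` of a product of groups acting by left multiplication on their disjoint
union. -/
def leftMul (h : ∀ i, G i) : Equiv.Perm (Σ i, G i) :=
  Equiv.sigmaCongrRight fun i => Equiv.mulLeft (h i)

@[simp] theorem leftMul_mk (h : ∀ i, G i) (i : ι) (g : G i) : leftMul h ⟨i, g⟩ = ⟨i, h i * g⟩ := rfl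

/-- The set of all points in blocks that come before the block of `x`, together with `x`. -/
def blockSet (ρ : ι → ℕ) (x : Σ i, G i) : Set (Σ i, G i) := {y | ρ y.1 < ρ x.1 ∨ y = x}

/-- The graph of `h`, meeting each block in one point. -/
def graphSet (h : ∀ i, G i) : Set (Σ i, G i) := {y | y.2 = h y.1}

/-- The graph of `h` with the further point `h i * c i` of the block `i`. -/
def markedGraphSet (c h : ∀ i, G i) (i : ι) : Set (Σ i, G i) := graphSet h ∪ {⟨i, h i * c i⟩}

/-- The family of subsets of the disjoint union that has `H` as its symmetry group. -/
def glueFamily (ρ : ι → ℕ) (H : Subgroup (∀ i, G i)) (L : ∀ i, Set (Set (G i))) (c : ∀ i, G i) :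
    Set (Set (Σ i, G i)) :=
  {S | (∃ x, S = blockSet ρ x) ∨ (∃ h ∈ H, S = graphSet h) ∨
    (∃ i, 3 ≤ Nat.card (G i) ∧ (∃ j, j ≠ i) ∧ ∃ h ∈ H, S = markedGraphSet c h i) ∨
    ∃ i, ∃ t ∈ L i, S = Sigma.mk i '' t}

theorem image_leftMul_mem_glueFamily {ρ : ι → ℕ} {H : Subgroup (∀ i, G i)}
    {L : ∀ i, Set (Set (G i))} {c : ∀ i, G i} (hL : ∀ i, ∀ g : G i, ∀ s ∈ L i, g • s ∈ L i)
    {h : ∀ i, G i} (hh : h ∈ H) {S : Set (Σ i, G i)} (hS : S ∈ glueFamily ρ H L c) :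
    leftMul h '' S ∈ glueFamily ρ H L c := by
  have key : ∀ k : ∀ i, G i, leftMul h '' graphSet k = graphSet (h * k) := by
    intro k
    ext ⟨i, g⟩
    rw [Equiv.image_eq_preimage_symm, Set.mem_preimage]
    change (h i)⁻¹ * g = k i ↔ g = h i * k i
    rw [inv_mul_eq_iff_eq_mul]
  rcases hS with ⟨x, rfl⟩ | ⟨k, hk, rfl⟩ | ⟨i, hi, hj, k, hk, rfl⟩ | ⟨i, t, ht, rfl⟩
  · refine Or.inl ⟨leftMul h x, ?_⟩
    ext y
    rw [Equiv.image_eq_preimage_symm, Set.mem_preimage]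
    exact or_congr Iff.rfl (by rw [Equiv.symm_apply_eq])
  · exact Or.inr (Or.inl ⟨h * k, mul_mem hh hk, key k⟩)
  · refine Or.inr (Or.inr (Or.inl ⟨i, hi, hj, h * k, mul_mem hh hk, ?_⟩))
    rw [markedGraphSet, Set.image_union, key, Set.image_singleton, markedGraphSet, leftMul_mk,
      Pi.mul_apply, mul_assoc]
  · refine Or.inr (Or.inr (Or.inr ⟨i, h i • t, hL i _ _ ht, ?_⟩))
    rw [Set.image_image]
    change _ = Sigma.mk i '' ((fun g => h i * g) '' t)
    rw [Set.image_image]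
    rfl

variable [∀ i, Finite (G i)]

/-- Induction on the rank of the block: the union of earlier blocks is preserved, so a stray `τ x`
lies in a later block. The image of `blockSet ρ x` then skips the block of `x`, unlike graphs and
block sets reaching that far, and has a single point in the block of `τ x`, unlike a set from `L`.
-/
theorem fst_eq_of_preserves_glueFamily [Finite ι] {ρ : ι → ℕ} (hρ : Function.Injective ρ)
    {H : Subgroup (∀ i, G i)} {L : ∀ i, Set (Set (G i))} {c : ∀ i, G i}
    (hL : ∀ i, ∀ s ∈ L i, 2 ≤ s.ncard) {τ : Equiv.Perm (Σ i, G i)}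
    (hτ : ∀ S ∈ glueFamily ρ H L c, τ '' S ∈ glueFamily ρ H L c) (x : Σ i, G i) :
    (τ x).1 = x.1 := by
  induction hN : ρ x.1 using Nat.strong_induction_on generalizing x with
  | _ N ih =>
  have hV : τ '' {y | ρ y.1 < N} = {y | ρ y.1 < N} := by
    refine Set.eq_of_subset_of_ncard_le ?_
      (Set.ncard_image_of_injective _ τ.injective).ge
    rintro _ ⟨y, hy, rfl⟩
    change ρ (τ y).1 < N
    rw [ih _ hy y rfl]
    exact hy
  have hge : N ≤ ρ (τ x).1 := by
    by_contra! hlt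
    have : τ x ∈ τ '' {y | ρ y.1 < N} := by rw [hV]; exact hlt
    obtain ⟨y, hy, hyx⟩ := this
    rw [τ.injective hyx] at hy
    exact absurd hN (ne_of_lt hy)
  have himg : τ '' blockSet ρ x = {y | ρ y.1 < N ∨ y = τ x} := by
    have : blockSet ρ x = {y | ρ y.1 < N} ∪ {x} := by rw [blockSet, hN]; rfl
    rw [this, Set.image_union, hV, Set.image_singleton]
    rfl
  by_contra hne
  have hgt : N < ρ (τ x).1 := lt_of_le_of_ne hge fun h => hne (hρ (h.symm.trans hN.symm))
  have hnot : ∀ g : G x.1, (⟨x.1, g⟩ : Σ i, G i) ∉ τ '' blockSet ρ x := by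
    intro g hg
    rw [himg] at hg
    rcases hg with hg | hg
    · exact absurd hN (ne_of_lt hg)
    · exact hne (by rw [← hg])
  rcases hτ _ (Or.inl ⟨x, rfl⟩) with ⟨z, hz⟩ | ⟨k, hk, hz⟩ | ⟨i, hi, hj, k, hk, hz⟩ | ⟨i, t, ht, hz⟩
  · have h1 := hnot 1
    rw [hz] at h1
    have h2 : ¬ ρ x.1 < ρ z.1 := fun h => h1 (Or.inl h)
    have h3 : τ x ∈ blockSet ρ z := by rw [← hz, himg]; exact Or.inr rfl
    rcases h3 with h3 | h3
    · omega
    · rw [h3] at hgt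
      omega
  · exact hnot (k x.1) (by rw [hz]; rfl)
  · exact hnot (k x.1) (by rw [hz]; exact Or.inl rfl)
  · have h1 : τ x ∈ Sigma.mk i '' t := by rw [← hz, himg]; exact Or.inr rfl
    obtain ⟨g, hg, hgx⟩ := h1
    obtain ⟨a, ha, b, hb, hab⟩ := (Set.one_lt_ncard (s := t)).1 (hL i t ht)
    have h2 : ∀ a ∈ t, a = g := by
      intro a ha
      have h3 : (⟨i, a⟩ : Σ i, G i) ∈ Sigma.mk i '' t := ⟨a, ha, rfl⟩
      rw [← hz, himg, ← hgx] at h3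
      rcases h3 with h3 | h3
      · rw [← hgx] at hgt
        exact absurd hgt (not_lt.2 (le_of_lt h3))
      · simpa using h3
    exact hab ((h2 a ha).trans (h2 b hb).symm)

variable {ρ : ι → ℕ} {H : Subgroup (∀ i, G i)} {L : ∀ i, Set (Set (G i))} {c : ∀ i, G i}
  {τ : Equiv.Perm (Σ i, G i)} {σ : ∀ i, Equiv.Perm (G i)}

/-- The image of the graph of `1` meets each block once, so it should be the graph of an element of
`H`. It can also be a block set, but then the blocks before the last are trivial, and surjectivity
onto the last one supplies the element. -/
theorem image_one_mem_of_preserves_glueFamily (hρ : Function.Injective ρ)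
    (hH : ∀ i g, ∃ h ∈ H, h i = g) (hL : ∀ i, ∀ s ∈ L i, 2 ≤ s.ncard)
    (hc : ∀ i, 3 ≤ Nat.card (G i) → c i ≠ 1)
    (hτ : ∀ S ∈ glueFamily ρ H L c, τ '' S ∈ glueFamily ρ H L c)
    (hσ : ∀ i g, τ ⟨i, g⟩ = ⟨i, σ i g⟩) : (fun i => σ i 1) ∈ H := by
  have hT : ∀ i g, (⟨i, g⟩ : Σ i, G i) ∈ τ '' graphSet 1 ↔ g = σ i 1 := by
    intro i g
    constructor
    · rintro ⟨⟨j, y⟩, hy, hyx⟩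
      obtain rfl : y = 1 := hy
      rw [hσ] at hyx
      cases hyx
      rfl
    · rintro rfl
      exact ⟨⟨i, 1⟩, rfl, hσ i 1⟩
  rcases hτ _ (Or.inr (Or.inl ⟨1, one_mem _, rfl⟩)) with
    ⟨x, hz⟩ | ⟨k, hk, hz⟩ | ⟨i, hi, hj, k, hk, hz⟩ | ⟨i, t, ht, hz⟩
  · obtain ⟨h, hh, hx⟩ := hH x.1 x.2
    convert hh using 1
    funext i
    rcases lt_trichotomy (ρ i) (ρ x.1) with hlt | heq | hgt
    · have h1 : ∀ g : G i, g = σ i 1 := fun g => by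
        rw [← hT, hz]; exact Or.inl hlt
      exact (h1 (h i)).symm
    · obtain rfl := hρ heq
      have h1 : (⟨x.1, σ x.1 1⟩ : Σ i, G i) ∈ blockSet ρ x := by rw [← hz, hT]
      rcases h1 with h1 | h1
      · exact absurd h1 (lt_irrefl _)
      · rw [hx]
        rcases x with ⟨j, y⟩
        simpa using h1
    · exfalso
      have h1 : (⟨i, σ i 1⟩ : Σ i, G i) ∈ blockSet ρ x := by rw [← hz, hT]
      rcases h1 with h1 | h1
      · exact absurd h1 (not_lt.2 hgt.le)
      · rw [← h1] at hgt
        exact lt_irrefl _ hgt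
  · convert hk using 1
    funext i
    rw [eq_comm, ← hT, hz]
    rfl
  · exfalso
    have h1 : k i = σ i 1 := by rw [← hT, hz]; exact Or.inl rfl
    have h2 : k i * c i = σ i 1 := by rw [← hT, hz]; exact Or.inr rfl
    rw [← h1] at h2
    exact hc i hi (by simpa using h2)
  · exfalso
    obtain ⟨a, ha, b, hb, hab⟩ := (Set.one_lt_ncard (s := t)).1 (hL i t ht)
    have h1 : a = σ i 1 := by rw [← hT, hz]; exact ⟨a, ha, rfl⟩
    have h2 : b = σ i 1 := by rw [← hT, hz]; exact ⟨b, hb, rfl⟩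
    exact hab (h1.trans h2.symm)

theorem image_mem_of_preserves_glueFamily (hL : ∀ i, ∀ s ∈ L i, 2 ≤ s.ncard)
    (hτ : ∀ S ∈ glueFamily ρ H L c, τ '' S ∈ glueFamily ρ H L c)
    (hσ : ∀ i g, τ ⟨i, g⟩ = ⟨i, σ i g⟩) (i : ι) : ∀ s ∈ L i, σ i '' s ∈ L i := by
  intro s hs
  have himg : τ '' (Sigma.mk i '' s) = Sigma.mk i '' (σ i '' s) := by
    rw [Set.image_image, Set.image_image]
    simp only [hσ]
  obtain ⟨a, ha, b, hb, hab⟩ := (Set.one_lt_ncard (s := σ i '' s)).1 (by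
    rw [Set.ncard_image_of_injective _ (σ i).injective]; exact hL i s hs)
  have hmem := hτ _ (Or.inr (Or.inr (Or.inr ⟨i, s, hs, rfl⟩)))
  rw [himg] at hmem
  have hblock : ∀ (j : ι) (g : G j), (⟨j, g⟩ : Σ i, G i) ∈ Sigma.mk i '' (σ i '' s) → j = i := by
    rintro j g ⟨y, -, hy⟩
    exact (congrArg Sigma.fst hy).symm
  have hin : ∀ g ∈ σ i '' s, (⟨i, g⟩ : Σ i, G i) ∈ Sigma.mk i '' (σ i '' s) :=
    fun g hg => ⟨g, hg, rfl⟩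
  rcases hmem with ⟨x, hz⟩ | ⟨k, hk, hz⟩ | ⟨j, hj, ⟨l, hl⟩, k, hk, hz⟩ | ⟨j, t, ht, hz⟩
  · exfalso
    rw [hz] at hin hblock
    have hx : x.1 = i := hblock x.1 x.2 (Or.inr rfl)
    have h1 : ∀ g ∈ σ i '' s, (⟨i, g⟩ : Σ i, G i) = x := fun g hg =>
      (hin g hg).resolve_left (by rw [hx]; exact lt_irrefl _)
    have := (h1 a ha).trans (h1 b hb).symm
    exact hab (by simpa using this)
  · exfalso
    rw [hz] at hin
    have h1 : a = k i := hin a ha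
    have h2 : b = k i := hin b hb
    exact hab (h1.trans h2.symm)
  -- A marked graph also meets another block; the clause `∃ j, j ≠ i` in `glueFamily` is there for
  -- this.
  · exfalso
    rw [hz] at hblock
    exact hl ((hblock l (k l) (Or.inl rfl)).trans (hblock j (k j) (Or.inl rfl)).symm)
  · have h1 := hin a ha
    rw [hz] at h1
    obtain ⟨y, -, hy⟩ := h1
    obtain rfl : j = i := congrArg Sigma.fst hy
    rw [sigma_mk_injective.image_injective hz]
    exact ht

/-- The marked graph of `1` can only go to a marked graph at `i` of some `h`, with `{h i, h i * c i}
= {1, σ i (c i)}`. Matching the points in the two possible orders gives the two alternatives. A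
block set is impossible because block `i` has at least three points. -/
theorem mark_of_preserves_glueFamily
    (hc : ∀ i, 3 ≤ Nat.card (G i) → c i ≠ 1)
    (hτ : ∀ S ∈ glueFamily ρ H L c, τ '' S ∈ glueFamily ρ H L c)
    (hσ : ∀ i g, τ ⟨i, g⟩ = ⟨i, σ i g⟩) (hσ1 : ∀ i, σ i 1 = 1) {i j : ι}
    (hi : 3 ≤ Nat.card (G i)) (hji : j ≠ i) :
    σ i (c i) = c i ∨ (σ i (c i) = (c i)⁻¹ ∧
      ∃ h ∈ H, h i = (c i)⁻¹ ∧ ∀ k, k ≠ i → h k = 1) := by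
  set d := σ i (c i) with hd
  have hd1 : d ≠ 1 := fun h => hc i hi ((σ i).injective (h.trans (hσ1 i).symm))
  have hT : τ '' markedGraphSet c 1 i = graphSet 1 ∪ {⟨i, d⟩} := by
    rw [markedGraphSet, Set.image_union, Set.image_singleton, hσ, Pi.one_apply, one_mul]
    congr 1
    ext ⟨k, g⟩
    constructor
    · rintro ⟨⟨l, y⟩, hy, hyx⟩
      obtain rfl : y = 1 := hy
      rw [hσ, hσ1] at hyx
      cases hyx
      rfl
    · intro h
      obtain rfl : g = 1 := h
      exact ⟨⟨k, 1⟩, rfl, by rw [hσ, hσ1]⟩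
  have m1 : ∀ k, (⟨k, 1⟩ : Σ i, G i) ∈ τ '' markedGraphSet c 1 i := fun k => by
    rw [hT]; exact Or.inl rfl
  have m2 : (⟨i, d⟩ : Σ i, G i) ∈ τ '' markedGraphSet c 1 i := by rw [hT]; exact Or.inr rfl
  have m3 : ∀ g, (⟨i, g⟩ : Σ i, G i) ∈ τ '' markedGraphSet c 1 i → g = 1 ∨ g = d := by
    intro g hg
    rw [hT] at hg
    rcases hg with hg | hg
    · exact Or.inl hg
    · exact Or.inr (by simpa using hg)
  have m4 : ∀ k g, k ≠ i → (⟨k, g⟩ : Σ i, G i) ∈ τ '' markedGraphSet c 1 i → g = 1 := by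
    intro k g hk hg
    rw [hT] at hg
    rcases hg with hg | hg
    · exact hg
    · exact absurd (congrArg Sigma.fst hg) hk
  rcases hτ _ (Or.inr (Or.inr (Or.inl ⟨i, hi, ⟨j, hji⟩, 1, one_mem _, rfl⟩))) with
    ⟨x, hz⟩ | ⟨k, hk, hz⟩ | ⟨k, hk, -, h, hh, hz⟩ | ⟨k, t, ht, hz⟩
  · exfalso
    rw [hz] at m1 m2 m3
    have hlt : ρ i < ρ x.1 := by
      rcases m1 i with h1 | h1
      · exact h1
      rcases m2 with h2 | h2
      · exact h2
      · exact absurd (by simpa using h2.trans h1.symm) hd1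
    have h3 : (Set.univ : Set (G i)) ⊆ {1, d} := fun g _ => m3 g (Or.inl hlt)
    have h4 := Set.ncard_le_ncard h3
    rw [Set.ncard_univ, Set.ncard_pair hd1.symm] at h4
    omega
  · exfalso
    rw [hz] at m1 m2
    have h1 : 1 = k i := m1 i
    have h2 : d = k i := m2
    exact hd1 (h2.trans h1.symm)
  · rw [hz] at m1 m2 m3 m4
    by_cases hki : k = i
    · subst hki
      have h1 : ∀ l, l ≠ k → h l = 1 := fun l hl => m4 l (h l) hl (Or.inl rfl)
      have hck : c k = 1 → False := hc k hi
      have e2 := m3 _ (Or.inr rfl)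
      rcases m3 (h k) (Or.inl rfl) with e | e
      · left
        rw [e, one_mul] at e2
        exact (e2.resolve_left hck).symm
      · right
        rw [e] at e2
        have e3 : d = (c k)⁻¹ :=
          eq_inv_of_mul_eq_one_left (e2.resolve_right fun h => hck (by simpa using h))
        exact ⟨e3, h, hh, e.trans e3, h1⟩
    · exfalso
      have key : ∀ g, (⟨i, g⟩ : Σ i, G i) ∈ markedGraphSet c h k → g = h i := by
        intro g hg
        rcases hg with hg | hg
        · exact hg
        · exact absurd (congrArg Sigma.fst hg).symm hki
      exact hd1 ((key _ m2).trans (key _ (m1 i)).symm)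
  · exfalso
    rw [hz] at m1
    obtain ⟨y, -, hy⟩ := m1 i
    obtain ⟨y', -, hy'⟩ := m1 j
    exact hji ((congrArg Sigma.fst hy').symm.trans (congrArg Sigma.fst hy))

/-- A subdirect product of groups acting on their disjoint union is the symmetry group of a family
of sets, unless it splits off a cyclic group of order `3`, `4` or `5`, or is a Klein four-group. -/
theorem exists_family_of_subdirect [Finite ι] (H : Subgroup (∀ i, G i)) (hH : ∀ i g, ∃ h ∈ H, h i = g)
    (hcyc : ∀ i, IsCyclic (G i) →
      (Nat.card (G i) = 3 ∨ Nat.card (G i) = 4 ∨ Nat.card (G i) = 5) →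
      ¬ ∀ g, ∃ h ∈ H, h i = g ∧ ∀ k, k ≠ i → h k = 1)
    (hklein : ∀ i, ¬ IsCyclic (G i) → Nat.card (G i) = 4 → ∃ j, j ≠ i) :
    ∃ F : Set (Set (Σ i, G i)), ∀ τ : Equiv.Perm (Σ i, G i),
      (∀ S ∈ F, τ '' S ∈ F) ↔ ∃ h ∈ H, τ = leftMul h := by
  obtain ⟨ρ, hρ⟩ := Countable.exists_injective_nat ι
  choose L c hP hcase using fun i => exists_pins (G := G i)
  have hL2 := fun i => (hP i).two_le
  have hLs := fun i => (hP i).smul_mem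
  have hc1 := fun i => (hP i).ne_one
  refine ⟨glueFamily ρ H L c, fun τ => ⟨fun hτ => ?_, ?_⟩⟩
  swap
  · rintro ⟨h, hh, rfl⟩ S hS
    exact image_leftMul_mem_glueFamily hLs hh hS
  obtain ⟨σ₀, hσ₀⟩ := exists_perm_of_fst_eq (fst_eq_of_preserves_glueFamily hρ hL2 hτ)
  have hh₀ := image_one_mem_of_preserves_glueFamily hρ hH hL2 hc1 hτ hσ₀
  set h₀ : ∀ i, G i := fun i => σ₀ i 1 with hh₀d
  refine ⟨h₀, hh₀, ?_⟩
  -- Dividing by `h₀` reduces to a permutation fixing every identity element.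
  let σ : ∀ i, Equiv.Perm (G i) := fun i => (σ₀ i).trans (Equiv.mulLeft (h₀ i)⁻¹)
  let τ' : Equiv.Perm (Σ i, G i) := τ.trans (leftMul h₀⁻¹)
  have hτ' : ∀ S ∈ glueFamily ρ H L c, τ' '' S ∈ glueFamily ρ H L c := by
    intro S hS
    have : τ' '' S = leftMul h₀⁻¹ '' (τ '' S) := by rw [Set.image_image]; rfl
    rw [this]
    exact image_leftMul_mem_glueFamily hLs (inv_mem hh₀) (hτ S hS)
  have hσ : ∀ i g, τ' ⟨i, g⟩ = ⟨i, σ i g⟩ := by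
    intro i g
    simp [τ', σ, hσ₀]
  have hσ1 : ∀ i, σ i 1 = 1 := fun i => by simp [σ, h₀]
  have hpres := image_mem_of_preserves_glueFamily hL2 hτ' hσ
  have hmark := fun i j => mark_of_preserves_glueFamily (i := i) (j := j) hc1 hτ' hσ hσ1
  have hone : ∀ i, σ i = 1 := by
    intro i
    rcases hcase i with h | ⟨h4, hnc, hcc⟩ | ⟨hgen, h345⟩
    · exact h _ (hpres i) (hσ1 i)
    · obtain ⟨j, hj⟩ := hklein i hnc h4
      refine (hP i).eq_one _ (hpres i) (hσ1 i) ?_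
      rcases hmark i j (by omega) hj with h | ⟨h, -⟩
      · exact h
      · rw [h, eq_comm]
        exact eq_inv_of_mul_eq_one_left hcc
    · have hcy : IsCyclic (G i) := ⟨c i, hgen⟩
      have hn := hcyc i hcy h345
      by_cases hex : ∃ j, j ≠ i
      · obtain ⟨j, hj⟩ := hex
        rcases hmark i j (by omega) hj with h | ⟨-, h, hh, hi, hk⟩
        · exact (hP i).eq_one _ (hpres i) (hσ1 i) h
        · exfalso
          refine hn fun g => ?_
          obtain ⟨n, rfl⟩ := hgen g
          refine ⟨h ^ (-n), zpow_mem hh _, ?_, fun k hki => ?_⟩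
          · simp [hi]
          · simp [hk k hki]
      · push Not at hex
        exact absurd (fun g => let ⟨h, hh, hg⟩ := hH i g
          ⟨h, hh, hg, fun k hk => absurd (hex k) hk⟩) hn
  ext1 ⟨i, g⟩
  have h1 := hσ i g
  rw [hone] at h1
  have h2 : leftMul h₀⁻¹ (τ ⟨i, g⟩) = ⟨i, g⟩ := h1
  rw [hσ₀] at h2 ⊢
  have h3 : (h₀ i)⁻¹ * σ₀ i g = g := by simpa using h2
  rw [leftMul_mk, ← h3, mul_inv_cancel_left]
  rw [h3]

end Glue

/-! ### Groups with regular orbits as subdirect products -/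

/-- Every element of `A` fixing a point fixes the whole orbit of that point. -/
def RegularOrbits {X : Type*} (A : Subgroup (Equiv.Perm X)) : Prop :=
  ∀ a ∈ A, ∀ x, a x = x → ∀ b ∈ A, a (b x) = b x

theorem regularOrbits_of_comm {X : Type*} {A : Subgroup (Equiv.Perm X)}
    (hA : ∀ a ∈ A, ∀ b ∈ A, a * b = b * a) : RegularOrbits A := fun a ha x hx b hb => by
  rw [← Equiv.Perm.mul_apply, hA a ha b hb, Equiv.Perm.mul_apply, hx]

theorem ContainedInSumOfRegular.regularOrbits {n : ℕ} {A : Subgroup (Equiv.Perm (Fin n))}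
    (hA : ContainedInSumOfRegular A) : RegularOrbits A := by
  obtain ⟨r, m, B, hB, e, hle⟩ := hA
  have key : ∀ a ∈ A, ∃ h : ∀ i, Equiv.Perm (Fin (m i)), (∀ i, h i ∈ B i) ∧
      ∀ i y, e (a (e.symm ⟨i, y⟩)) = ⟨i, h i y⟩ := by
    intro a ha
    obtain ⟨h, hh, hha⟩ := hle (Subgroup.mem_map_of_mem _ ha)
    refine ⟨h, fun i => hh i (Set.mem_univ i), fun i y => ?_⟩
    exact (congrArg (fun p : Equiv.Perm (Σ i, Fin (m i)) => p ⟨i, y⟩) hha).symm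
  intro a ha x hx b hb
  obtain ⟨h, hh, hha⟩ := key a ha
  obtain ⟨k, -, hkb⟩ := key b hb
  obtain ⟨⟨i, y⟩, rfl⟩ := e.symm.surjective x
  have h1 : h i y = y := by
    have := hha i y
    rw [hx, Equiv.apply_symm_apply] at this
    simpa using this.symm
  have h2 : h i = 1 := by
    have h3 : (⟨h i, hh i⟩ : B i) ∈ MulAction.stabilizer (B i) y := h1
    rw [(hB i).2 y] at h3
    exact congrArg Subtype.val (Subgroup.mem_bot.1 h3)
  have h4 : b (e.symm ⟨i, y⟩) = e.symm ⟨i, k i y⟩ := by rw [← hkb, Equiv.symm_apply_apply]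
  rw [h4]
  apply e.injective
  rw [hha, h2, Equiv.apply_symm_apply]
  rfl

/-- A permutation group all of whose orbits are regular acts as a subdirect product of groups does
on their disjoint union. -/
theorem RegularOrbits.exists_subdirect {X : Type} [Finite X] {A : Subgroup (Equiv.Perm X)}
    (hA : RegularOrbits A) :
    ∃ (ι : Type) (G : ι → Type) (_ : Finite ι) (_ : ∀ i, Group (G i)) (_ : ∀ i, Finite (G i))
      (H : Subgroup (∀ i, G i)) (e : X ≃ Σ i, G i), (∀ i g, ∃ h ∈ H, h i = g) ∧
      ∀ σ : Equiv.Perm X, σ ∈ A ↔ ∃ h ∈ H, e.permCongr σ = leftMul h := by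
  -- A stabilizer fixes the whole orbit pointwise, so it is the kernel of the action there; this
  -- makes the orbit a quotient group of `A`.
  have hn : ∀ x : X, (MulAction.stabilizer A x).Normal := by
    refine fun x => ⟨fun a ha b => ?_⟩
    change (b * a * b⁻¹ : A) • x = x
    have h1 : (a : Equiv.Perm X) ((b⁻¹ : A) • x) = (b⁻¹ : A) • x :=
      hA a a.2 x ha (b⁻¹ : A) (b⁻¹ : A).2
    have h2 : a • ((b⁻¹ : A) • x) = (b⁻¹ : A) • x := h1
    rw [mul_smul, mul_smul, h2, smul_inv_smul]
  let Ω := MulAction.orbitRel.Quotient A X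
  let H : Subgroup (∀ ω : Ω, A ⧸ MulAction.stabilizer A ω.out) :=
    (MonoidHom.pi fun ω : Ω => QuotientGroup.mk' (MulAction.stabilizer A ω.out)).range
  let e := MulAction.selfEquivSigmaOrbitsQuotientStabilizer A X
  have he : ∀ (ω : Ω) (a : A), e.symm ⟨ω, (a : A ⧸ MulAction.stabilizer A ω.out)⟩ = a • ω.out :=
    fun ω a => rfl
  have hleft : ∀ a : A, e.permCongr (a : Equiv.Perm X) =
      leftMul fun ω : Ω => (a : A ⧸ MulAction.stabilizer A ω.out) := by
    intro a
    ext1 ⟨ω, g⟩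
    obtain ⟨b, rfl⟩ := QuotientGroup.mk_surjective g
    rw [Equiv.permCongr_apply, leftMul_mk, ← Equiv.eq_symm_apply, he, ← QuotientGroup.mk_mul, he,
      mul_smul]
    rfl
  refine ⟨Ω, fun ω => A ⧸ MulAction.stabilizer A ω.out, inferInstance, inferInstance,
    fun ω => Quotient.finite _, H, e, ?_, ?_⟩
  · intro ω g
    obtain ⟨b, rfl⟩ := QuotientGroup.mk_surjective g
    exact ⟨_, ⟨b, rfl⟩, rfl⟩
  · intro σ
    constructor
    · intro hσ
      exact ⟨_, ⟨⟨σ, hσ⟩, rfl⟩, hleft ⟨σ, hσ⟩⟩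
    · rintro ⟨_, ⟨a, rfl⟩, h⟩
      have h1 := h.trans (hleft a).symm
      rw [e.permCongr.injective h1]
      exact a.2

theorem RegularOrbits.containedInSumOfRegular {n : ℕ} {A : Subgroup (Equiv.Perm (Fin n))}
    (hA : RegularOrbits A) : ContainedInSumOfRegular A := by
  obtain ⟨ι, G, _, _, _, H, e, -, hH⟩ := hA.exists_subdirect
  let q := (Finite.equivFin ι).symm
  let F : ∀ j, Fin (Nat.card (G (q j))) ≃ G (q j) := fun j => (Finite.equivFin _).symm
  let E := Equiv.sigmaCongr q F
  let B : ∀ j, Subgroup (Equiv.Perm (Fin (Nat.card (G (q j))))) := fun j =>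
    ((MulAction.toPermHom (G (q j)) (G (q j))).range).map
      ((F j).symm.permCongrHom : Equiv.Perm (G (q j)) →* Equiv.Perm (Fin (Nat.card (G (q j)))))
  have hmem : ∀ j (g : G (q j)), (F j).symm.permCongrHom (Equiv.mulLeft g) ∈ B j := fun j g =>
    ⟨Equiv.mulLeft g, ⟨g, rfl⟩, rfl⟩
  refine ⟨Nat.card ι, fun j => Nat.card (G (q j)), B, fun j => ⟨⟨fun x y => ?_⟩, fun x => ?_⟩,
    e.trans E.symm, ?_⟩
  · refine ⟨⟨_, hmem j (F j y * (F j x)⁻¹)⟩, ?_⟩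
    change (F j).symm ((F j y * (F j x)⁻¹) * F j x) = y
    simp
  · rw [eq_bot_iff]
    rintro ⟨_, _, ⟨g, rfl⟩, rfl⟩ hx
    have h1 : (F j).symm (g * F j x) = x := hx
    rw [Equiv.symm_apply_eq] at h1
    have h2 : g = 1 := by simpa using h1
    subst h2
    rw [Subgroup.mem_bot]
    ext1
    change (F j).symm.permCongrHom _ = 1
    rw [map_one, map_one]
  · rintro _ ⟨a, ha, rfl⟩
    obtain ⟨h, -, hha⟩ := (hH a).1 ha
    refine ⟨fun j => (F j).symm.permCongrHom (Equiv.mulLeft (h (q j))),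
      fun j _ => hmem j _, ?_⟩
    ext1 ⟨j, y⟩
    change (⟨j, (F j).symm (h (q j) * F j y)⟩ : Σ j, Fin (Nat.card (G (q j)))) =
      E.symm (e (a (e.symm (E ⟨j, y⟩))))
    have h1 : e (a (e.symm (E ⟨j, y⟩))) = leftMul h (E ⟨j, y⟩) := by rw [← hha]; rfl
    rw [h1, Equiv.eq_symm_apply]
    change (⟨q j, F j ((F j).symm (h (q j) * F j y))⟩ : Σ i, G i) = ⟨q j, h (q j) * F j y⟩
    rw [Equiv.apply_symm_apply]

/-! ### From set families to functions; recognizing the excluded groups -/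

/-- A group carried onto the symmetry group of a family of sets is representable. -/
theorem representable_two_of_family {n : ℕ} {A : Subgroup (Equiv.Perm (Fin n))} {Y : Type*}
    (e : Fin n ≃ Y) (F : Set (Set Y))
    (hF : ∀ σ : Equiv.Perm (Fin n), (∀ S ∈ F, e.permCongr σ '' S ∈ F) ↔ σ ∈ A) :
    Representable 2 A := by
  classical
  refine ⟨fun x => if e '' {i | x i = true} ∈ F then 1 else 0, ?_⟩
  have himg : ∀ (σ : Equiv.Perm (Fin n)) (x : Fin n → Bool),
      e '' {i | x (σ i) = true} = e.permCongr σ⁻¹ '' (e '' {i | x i = true}) := by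
    intro σ x
    rw [Set.image_image]
    simp only [Equiv.permCongr_apply, Equiv.symm_apply_apply]
    rw [← Set.image_image e (fun i => σ⁻¹ i)]
    congr 1
    exact (Equiv.image_symm_eq_preimage σ {i | x i = true}).symm
  have hif : ∀ P Q : Prop, ((if P then (1 : Fin 2) else 0) = if Q then 1 else 0) ↔ (P ↔ Q) := by
    intro P Q
    by_cases hP : P <;> by_cases hQ : Q <;> simp [hP, hQ]
  ext σ
  refine (forall_congr' fun x : Fin n → Bool => hif (e '' {i | x (σ i) = true} ∈ F) _).trans ?_
  simp only [himg]
  constructor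
  · intro h
    have h1 : σ⁻¹ ∈ A := by
      rw [← hF]
      intro S hS
      have h2 := h fun i => decide (e i ∈ S)
      have h3 : e '' {i | decide (e i ∈ S) = true} = S := by
        ext y
        constructor
        · rintro ⟨i, hi, rfl⟩
          simpa using hi
        · intro hy
          exact ⟨e.symm y, by simpa using hy, by simp⟩
      rw [h3] at h2
      exact h2.2 hS
    simpa using inv_mem h1
  · intro hσ x
    refine ⟨fun h => ?_, (hF σ⁻¹).2 (inv_mem hσ) _⟩
    have h1 := (hF σ).2 hσ _ h
    rw [← himg] at h1
    have h2 : ∀ S : Set Y, e.permCongr σ '' (e.permCongr σ⁻¹ '' S) = S := by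
      intro S
      rw [Set.image_image]
      simp
    rwa [himg, h2] at h1

/-- A direct summand splits off as soon as it acts independently of the rest. -/
theorem eq_directSum_of_split {X Y : Type*} {C : Subgroup (Equiv.Perm X)}
    {B : Subgroup (Equiv.Perm (X ⊕ Y))}
    (h1 : ∀ b ∈ B, ∃ c ∈ C, ∃ d, b = Equiv.Perm.sumCongr c d)
    (h2 : ∀ c ∈ C, Equiv.Perm.sumCongr c 1 ∈ B) :
    B = directSum C (B.comap ((Equiv.Perm.sumCongrHom X Y).comp (MonoidHom.inr _ _))) := by
  ext b
  constructor
  · intro hb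
    obtain ⟨c, hc, d, rfl⟩ := h1 b hb
    refine ⟨(c, d), ⟨hc, ?_⟩, rfl⟩
    change Equiv.Perm.sumCongr 1 d ∈ B
    have := mul_mem (inv_mem (h2 c hc)) hb
    rwa [Equiv.Perm.sumCongr_inv, Equiv.Perm.sumCongr_mul, inv_mul_cancel, inv_one, one_mul] at this
  · rintro ⟨⟨c, d⟩, ⟨hc, hd⟩, rfl⟩
    have h3 : Equiv.Perm.sumCongr 1 d ∈ B := hd
    have := mul_mem (h2 c hc) h3
    rwa [Equiv.Perm.sumCongr_mul, mul_one, one_mul] at this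

theorem exists_fin_equiv_of_generator {G : Type*} [Group G] [Finite G] {c : G}
    (hc : ∀ x, x ∈ Subgroup.zpowers c) {m : ℕ} (hm : Nat.card G = m)
    (h345 : m = 3 ∨ m = 4 ∨ m = 5) :
    ∃ φ : Fin m ≃ G, ∀ k, φ (finRotate m k) = c * φ k := by
  have hord : orderOf c = m := by rw [orderOf_eq_card_of_forall_mem_zpowers hc, hm]
  have hinj : Function.Injective fun k : Fin m => c ^ (k : ℕ) := by
    intro a b hab
    exact Fin.ext (pow_injOn_Iio_orderOf (by rw [hord]; exact a.2) (by rw [hord]; exact b.2) hab)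
  have hbij := (Nat.bijective_iff_injective_and_card _).2 ⟨hinj, by rw [hm, Nat.card_fin]⟩
  -- Only three degrees occur, so the formula is checked by evaluation.
  have hrot : ∀ k : Fin m, (finRotate m k : ℕ) = (k + 1) % m := by
    rcases h345 with rfl | rfl | rfl <;> decide
  refine ⟨Equiv.ofBijective _ hbij, fun k => ?_⟩
  change c ^ (finRotate m k : ℕ) = c * c ^ (k : ℕ)
  have := pow_mod_orderOf c (k + 1)
  rw [hord] at this
  rw [hrot, this, pow_succ']

section Excluded
variable {n : ℕ} {A : Subgroup (Equiv.Perm (Fin n))} {ι : Type} {G : ι → Type}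
  [∀ i, Group (G i)] {H : Subgroup (∀ i, G i)} {e : Fin n ≃ Σ i, G i}

/-- Listing block `i` first and the other points after it exhibits `C_i ⊕ D`. When `i` is the only
block, `D` acts on zero points, so the alternative of a bare `C_i` is not needed. -/
theorem isExcluded_of_cyclic_summand [∀ i, Finite (G i)]
    (hA : ∀ σ : Equiv.Perm (Fin n), σ ∈ A ↔ ∃ h ∈ H, e.permCongr σ = leftMul h) {i : ι}
    (hcyc : IsCyclic (G i))
    (h345 : Nat.card (G i) = 3 ∨ Nat.card (G i) = 4 ∨ Nat.card (G i) = 5)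
    (hsingle : ∀ g, ∃ h ∈ H, h i = g ∧ ∀ k, k ≠ i → h k = 1) : IsExcluded A := by
  obtain ⟨c, hc⟩ := hcyc.exists_generator
  obtain ⟨φ, hφ⟩ := exists_fin_equiv_of_generator hc rfl h345
  let χ := (Finite.equivFin {x : Fin n // (e x).1 ≠ i}).symm
  let f : Fin (Nat.card (G i)) ⊕ Fin (Nat.card {x : Fin n // (e x).1 ≠ i}) → Fin n :=
    Sum.elim (fun a => e.symm ⟨i, φ a⟩) (fun b => (χ b).1)
  have hf : Function.Bijective f := by
    constructor
    · rintro (a | a) (b | b) hab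
      · have : (⟨i, φ a⟩ : Σ i, G i) = ⟨i, φ b⟩ := e.symm.injective hab
        simpa using this
      · exact absurd (congrArg (fun x => (e x).1) hab).symm (by simpa [f] using (χ b).2)
      · exact absurd (congrArg (fun x => (e x).1) hab) (by simpa [f] using (χ a).2)
      · have : χ a = χ b := Subtype.ext hab
        simpa using this
    · intro x
      by_cases hx : (e x).1 = i
      · obtain ⟨⟨j, g⟩, rfl⟩ := e.symm.surjective x
        rw [Equiv.apply_symm_apply] at hx
        obtain rfl : j = i := hx
        exact ⟨Sum.inl (φ.symm g), by simp [f]⟩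
      · exact ⟨Sum.inr (χ.symm ⟨x, hx⟩), by simp [f]⟩
  let ψ := Equiv.ofBijective f hf
  let Φ : Equiv.Perm (Fin n) →*
      Equiv.Perm (Fin (Nat.card (G i)) ⊕ Fin (Nat.card {x : Fin n // (e x).1 ≠ i})) :=
    (ψ.symm.permCongrHom : Equiv.Perm (Fin n) ≃* _)
  have hinl : ∀ a, ψ (Sum.inl a) = e.symm ⟨i, φ a⟩ := fun a => rfl
  have hinr : ∀ b, (e (ψ (Sum.inr b))).1 ≠ i := fun b => (χ b).2
  have hpow : ∀ t : ℕ, ∀ k, φ ((finRotate _ ^ t) k) = c ^ t * φ k := by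
    intro t
    induction t with
    | zero => simp
    | succ t ih =>
      intro k
      rw [pow_succ', Equiv.Perm.mul_apply, hφ, ih, pow_succ', mul_assoc]
  have hact : ∀ a h, e.permCongr a = leftMul h → ∀ t : ℕ, h i = c ^ t → ∀ k,
      ψ.symm (a (ψ (Sum.inl k))) = Sum.inl ((finRotate _ ^ t) k) := by
    intro a h hah t ht k
    rw [Equiv.symm_apply_eq, hinl, hinl, Equiv.eq_symm_apply, hpow, ← ht]
    exact congrArg (fun p : Equiv.Perm (Σ i, G i) => p ⟨i, φ k⟩) hah
  have hpowc : ∀ g : G i, ∃ t : ℕ, g = c ^ t := fun g => by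
    obtain ⟨t, rfl⟩ := mem_powers_iff_mem_zpowers.2 (hc g)
    exact ⟨t, rfl⟩
  refine Or.inr ⟨Nat.card (G i), h345, Or.inr ⟨_, _, ψ.symm, eq_directSum_of_split ?_ ?_⟩⟩
  · rintro _ ⟨a, ha, rfl⟩
    obtain ⟨h, hh, hah⟩ := (hA a).1 ha
    obtain ⟨t, ht⟩ := hpowc (h i)
    have hb : ∀ k, Φ a (Sum.inl k) =
        Sum.inl ((finRotate _ ^ t) k) := hact a h hah t ht
    obtain ⟨⟨c', d⟩, hcd⟩ := Equiv.Perm.mem_sumCongrHom_range_of_perm_mapsTo_inl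
      (σ := Φ a) (by
        rintro _ ⟨k, rfl⟩
        rw [hb]
        exact ⟨_, rfl⟩)
    refine ⟨c', ?_, d, hcd.symm⟩
    have : c' = finRotate _ ^ t := by
      ext1 k
      have h1 := hb k
      rw [← hcd] at h1
      exact Sum.inl.inj h1
    rw [this]
    exact Subgroup.npow_mem_zpowers _ t
  · intro c' hc'
    have hle : cyclicPerm (Nat.card (G i)) ≤
        (A.map Φ).comap
          ((Equiv.Perm.sumCongrHom _ _).comp (MonoidHom.inl _ _)) := by
      rw [cyclicPerm, Subgroup.zpowers_le]
      obtain ⟨h, hh, hi, hk⟩ := hsingle c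
      have hmem : e.permCongr.symm (leftMul h) ∈ A := (hA _).2 ⟨h, hh, e.permCongr.apply_symm_apply _⟩
      refine ⟨_, hmem, ?_⟩
      ext1 (k | k)
      · have := hact _ h (Equiv.apply_symm_apply _ _) 1 (by rw [hi, pow_one]) k
        rw [pow_one] at this
        exact this
      · change ψ.symm (e.symm (leftMul h (e.symm.symm (ψ (Sum.inr k))))) = Sum.inr k
        have h1 := hinr k
        rw [Equiv.symm_apply_eq, Equiv.symm_apply_eq]
        change leftMul h (e (ψ (Sum.inr k))) = _
        rcases he : e (ψ (Sum.inr k)) with ⟨j, g⟩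
        rw [he] at h1
        rw [leftMul_mk, hk j h1, one_mul]
    exact hle hc'

theorem isExcluded_of_klein [∀ i, Finite (G i)]
    (hA : ∀ σ : Equiv.Perm (Fin n), σ ∈ A ↔ ∃ h ∈ H, e.permCongr σ = leftMul h)
    (hH : ∀ i g, ∃ h ∈ H, h i = g) {i : ι}
    (hcyc : ¬ IsCyclic (G i)) (h4 : Nat.card (G i) = 4) (hi : ∀ j, j = i) : IsExcluded A := by
  obtain ⟨hsq, a, b, ha, hb, hab, hcomm, hall⟩ := klein_of_not_isCyclic hcyc h4
  let p : Fin 4 → G i := ![1, a, b, a * b]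
  have hp : Function.Bijective p := by
    rw [Nat.bijective_iff_surjective_and_card]
    refine ⟨fun x => ?_, by rw [h4, Nat.card_fin]⟩
    rcases hall x with rfl | rfl | rfl | rfl
    · exact ⟨0, rfl⟩
    · exact ⟨1, rfl⟩
    · exact ⟨2, rfl⟩
    · exact ⟨3, rfl⟩
  let f : Fin 4 → Fin n := fun k => e.symm ⟨i, p k⟩
  have hf : Function.Bijective f := by
    refine ⟨fun k l hkl => ?_, fun x => ?_⟩
    · have : (⟨i, p k⟩ : Σ i, G i) = ⟨i, p l⟩ := e.symm.injective hkl
      exact hp.1 (by simpa using this)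
    · obtain ⟨⟨j, g⟩, rfl⟩ := e.symm.surjective x
      obtain rfl := hi j
      obtain ⟨k, rfl⟩ := hp.2 g
      exact ⟨k, rfl⟩
  let ψ := Equiv.ofBijective f hf
  have hact : ∀ σ h, e.permCongr σ = leftMul h → ∀ π : Equiv.Perm (Fin 4),
      (∀ k, h i * p k = p (π k)) → (ψ.symm.permCongrHom : Equiv.Perm (Fin n) →* _) σ = π := by
    intro σ h hσ π hπ
    ext1 k
    change ψ.symm (σ (ψ k)) = π k
    rw [Equiv.symm_apply_eq]
    change σ (e.symm ⟨i, p k⟩) = e.symm ⟨i, p (π k)⟩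
    rw [← hπ, Equiv.eq_symm_apply]
    exact congrArg (fun q : Equiv.Perm (Σ i, G i) => q ⟨i, p k⟩) hσ
  have hsq' : ∀ x y : G i, x * (x * y) = y := fun x y => by rw [← mul_assoc, hsq, one_mul]
  have ea : ∀ k, a * p k = p ((Equiv.swap 0 1 * Equiv.swap 2 3 : Equiv.Perm (Fin 4)) k) := by
    have s : ∀ k, (Equiv.swap 0 1 * Equiv.swap 2 3 : Equiv.Perm (Fin 4)) k = ![1, 0, 3, 2] k := by
      decide
    intro k
    rw [s]
    fin_cases k <;> simp [p, hsq, hsq']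
  have eb : ∀ k, b * p k = p ((Equiv.swap 0 2 * Equiv.swap 1 3 : Equiv.Perm (Fin 4)) k) := by
    have s : ∀ k, (Equiv.swap 0 2 * Equiv.swap 1 3 : Equiv.Perm (Fin 4)) k = ![2, 3, 0, 1] k := by
      decide
    intro k
    rw [s]
    fin_cases k <;> simp [p, hsq, hsq', hcomm]
  have hla : (Equiv.swap 0 1 * Equiv.swap 2 3 : Equiv.Perm (Fin 4)) ∈ kleinPerm :=
    Subgroup.subset_closure (Or.inl rfl)
  have hlb : (Equiv.swap 0 2 * Equiv.swap 1 3 : Equiv.Perm (Fin 4)) ∈ kleinPerm :=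
    Subgroup.subset_closure (Or.inr rfl)
  refine Or.inl ⟨ψ.symm, le_antisymm ?_ ?_⟩
  · rintro _ ⟨σ, hσ, rfl⟩
    obtain ⟨h, hh, hσh⟩ := (hA σ).1 hσ
    rcases hall (h i) with e1 | e1 | e1 | e1
    · rw [hact σ h hσh 1 fun k => by rw [e1, one_mul]; rfl]
      exact one_mem _
    · rw [hact σ h hσh _ fun k => by rw [e1]; exact ea k]
      exact hla
    · rw [hact σ h hσh _ fun k => by rw [e1]; exact eb k]
      exact hlb
    · rw [hact σ h hσh (Equiv.swap 0 1 * Equiv.swap 2 3 * (Equiv.swap 0 2 * Equiv.swap 1 3))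
        fun k => by rw [e1, mul_assoc, eb, ea]; rfl]
      exact mul_mem hla hlb
  · have hin : ∀ g : G i, ∀ π : Equiv.Perm (Fin 4), (∀ k, g * p k = p (π k)) →
        π ∈ A.map (ψ.symm.permCongrHom : Equiv.Perm (Fin n) →* _) := by
      intro g π hπ
      obtain ⟨h, hh, rfl⟩ := hH i g
      exact ⟨e.permCongr.symm (leftMul h), (hA _).2 ⟨h, hh, e.permCongr.apply_symm_apply _⟩,
        hact _ h (e.permCongr.apply_symm_apply _) π hπ⟩
    rw [kleinPerm, Subgroup.closure_le]
    rintro π (rfl | rfl)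
    · exact hin a _ ea
    · exact hin b _ eb

end Excluded

theorem RegularOrbits.representable_two {n : ℕ} {A : Subgroup (Equiv.Perm (Fin n))}
    (hA : RegularOrbits A) (hex : ¬ IsExcluded A) : Representable 2 A := by
  obtain ⟨ι, G, _, _, _, H, e, hsurj, hH⟩ := hA.exists_subdirect
  obtain ⟨F, hF⟩ := exists_family_of_subdirect H hsurj
    (fun i hc h345 hs => hex (isExcluded_of_cyclic_summand hH hc h345 hs))
    (fun i hc h4 => by
      by_contra! h
      exact hex (isExcluded_of_klein hH hsurj hc h4 h))
  exact representable_two_of_family e F fun σ => by rw [hF, hH]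

/-! ### Non-representability, and three values for the Klein group -/

/-- A function invariant under `B` is automatically invariant under any `ρ` that agrees on each
single word with some element of `B`, the element being allowed to depend on the word. -/
theorem not_representable_of_permIso {n : ℕ} {A : Subgroup (Equiv.Perm (Fin n))} {Y : Type*}
    {B : Subgroup (Equiv.Perm Y)} (hAB : PermIso A B) {ρ : Equiv.Perm Y} (hρ : ρ ∉ B)
    (h : ∀ y : Y → Bool, ∃ b ∈ B, y ∘ b = y ∘ ρ) (k : ℕ) : ¬ Representable k A := by
  rintro ⟨f, rfl⟩
  obtain ⟨e, rfl⟩ := hAB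
  refine hρ ⟨e.symm.permCongr ρ, ?_, ?_⟩
  · intro x
    obtain ⟨_, ⟨a, ha, rfl⟩, hb⟩ := h (x ∘ e.symm)
    rw [← ha x]
    congr 1
    funext i
    have := congrFun hb (e i)
    simpa using this.symm
  · ext1 y
    simp

/-- Powers of the rotation commute with it, whereas the reversal does not. -/
theorem revPerm_notMem_cyclicPerm {i : ℕ} (h345 : i = 3 ∨ i = 4 ∨ i = 5) :
    (Fin.revPerm : Equiv.Perm (Fin i)) ∉ cyclicPerm i := by
  intro h
  have hcomm : ∀ k, finRotate i (Fin.revPerm k) = Fin.revPerm (finRotate i k) := by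
    obtain ⟨t, ht⟩ := h
    intro k
    rw [← Equiv.Perm.mul_apply, ← Equiv.Perm.mul_apply, ← ht]
    exact congrArg (fun p : Equiv.Perm (Fin i) => p k) (Commute.zpow_right (Commute.refl _) t).eq
  revert hcomm
  rcases h345 with rfl | rfl | rfl <;> decide

/-- Binary necklaces with 3, 4 or 5 beads have no chirality; this finite fact is evaluated. -/
theorem exists_cyclicPerm_comp_eq_rev {i : ℕ} (h345 : i = 3 ∨ i = 4 ∨ i = 5) (y : Fin i → Bool) :
    ∃ b ∈ cyclicPerm i, y ∘ b = y ∘ Fin.revPerm := by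
  have key : ∃ t : Fin i, ∀ k, y ((finRotate i ^ (t : ℕ)) k) = y (Fin.revPerm k) := by
    revert y
    rcases h345 with rfl | rfl | rfl <;> decide
  obtain ⟨t, ht⟩ := key
  exact ⟨_, Subgroup.npow_mem_zpowers _ t, funext ht⟩

theorem not_representable_of_permIso_cyclicPerm {n : ℕ} {A : Subgroup (Equiv.Perm (Fin n))} {i : ℕ}
    (h345 : i = 3 ∨ i = 4 ∨ i = 5) (hA : PermIso A (cyclicPerm i)) (k : ℕ) : ¬ Representable k A :=
  not_representable_of_permIso hA (revPerm_notMem_cyclicPerm h345)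
    (exists_cyclicPerm_comp_eq_rev h345) k

theorem not_representable_of_permIso_directSum {n : ℕ} {A : Subgroup (Equiv.Perm (Fin n))}
    {i m : ℕ} {D : Subgroup (Equiv.Perm (Fin m))} (h345 : i = 3 ∨ i = 4 ∨ i = 5)
    (hA : PermIso A (directSum (cyclicPerm i) D)) (k : ℕ) : ¬ Representable k A := by
  refine not_representable_of_permIso hA (ρ := Equiv.Perm.sumCongr Fin.revPerm 1) ?_ ?_ k
  · rintro ⟨⟨c, d⟩, ⟨hc, -⟩, h⟩
    refine revPerm_notMem_cyclicPerm h345 ?_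
    have : c = Fin.revPerm := by
      ext1 k
      exact Sum.inl.inj (congrArg (fun p : Equiv.Perm (Fin i ⊕ Fin m) => p (Sum.inl k)) h)
    rwa [← this]
  · intro y
    obtain ⟨b, hb, h⟩ := exists_cyclicPerm_comp_eq_rev h345 (y ∘ Sum.inl)
    refine ⟨Equiv.Perm.sumCongr b 1, ⟨(b, 1), ⟨hb, one_mem _⟩, rfl⟩, ?_⟩
    funext x
    rcases x with x | x
    · exact congrFun h x
    · rfl

/-- A function distinguishing the three partitions of four points into pairs. -/
def pairingColor (y : Fin 4 → Bool) : Fin 3 :=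
  if y 0 = y 1 ∧ y 2 = y 3 ∧ y 0 ≠ y 2 then 1
  else if y 0 = y 2 ∧ y 1 = y 3 ∧ y 0 ≠ y 1 then 2 else 0

/-- Preserving colours 1 and 2 preserves two of the three pairings, and hence the third, which may
share colour 0 with all remaining words. The permutations preserving each pairing form `K_4`. -/
theorem symmetryGroup_pairingColor : symmetryGroup pairingColor = kleinPerm := by
  refine le_antisymm (fun σ hσ => ?_) ?_
  · have h : σ = 1 ∨ σ = Equiv.swap 0 1 * Equiv.swap 2 3 ∨
        σ = Equiv.swap 0 2 * Equiv.swap 1 3 ∨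
        σ = Equiv.swap 0 1 * Equiv.swap 2 3 * (Equiv.swap 0 2 * Equiv.swap 1 3) := by
      have hσ' : ∀ y : Fin 4 → Bool, pairingColor (fun i => y (σ i)) = pairingColor y := hσ
      clear hσ
      revert σ
      decide
    have hla : (Equiv.swap 0 1 * Equiv.swap 2 3 : Equiv.Perm (Fin 4)) ∈ kleinPerm :=
      Subgroup.subset_closure (Or.inl rfl)
    have hlb : (Equiv.swap 0 2 * Equiv.swap 1 3 : Equiv.Perm (Fin 4)) ∈ kleinPerm :=
      Subgroup.subset_closure (Or.inr rfl)
    rcases h with rfl | rfl | rfl | rfl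
    · exact one_mem _
    · exact hla
    · exact hlb
    · exact mul_mem hla hlb
  · rw [kleinPerm, Subgroup.closure_le]
    rintro π (rfl | rfl)
    · change ∀ y : Fin 4 → Bool, _
      decide
    · change ∀ y : Fin 4 → Bool, _
      decide

theorem Representable.of_permIso {n m k : ℕ} {A : Subgroup (Equiv.Perm (Fin n))}
    {B : Subgroup (Equiv.Perm (Fin m))} (hAB : PermIso A B) (hB : Representable k B) :
    Representable k A := by
  obtain ⟨f, hf⟩ := hB
  obtain ⟨e, he⟩ := hAB
  refine ⟨fun x => f (x ∘ e.symm), ?_⟩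
  ext σ
  have h1 : σ ∈ A ↔ e.permCongr σ ∈ symmetryGroup f := by
    rw [hf, ← he]
    constructor
    · intro h
      exact ⟨σ, h, rfl⟩
    · rintro ⟨a, ha, h⟩
      rwa [← e.permCongr.injective h]
  rw [h1]
  constructor
  · intro h y
    have := h (y ∘ e)
    simpa [Function.comp_def] using this
  · intro h x
    have := h (x ∘ e.symm)
    simpa [Function.comp_def] using this

end BoolSymm

theorem mainTheorem1 (n : ℕ) (A : Subgroup (Equiv.Perm (Fin n))) :
    ((∀ a ∈ A, ∀ b ∈ A, a * b = b * a) → BoolSymm.ContainedInSumOfRegular A) ∧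
    (BoolSymm.ContainedInSumOfRegular A →
      (¬ BoolSymm.IsExcluded A → BoolSymm.Representable 2 A) ∧
      (BoolSymm.IsExcluded A →
        (∀ k : ℕ, 2 ≤ k → ¬ BoolSymm.Representable k A) ∨
        (BoolSymm.PermIso A BoolSymm.kleinPerm ∧ BoolSymm.Representable 3 A))) := by
  refine ⟨fun h => (BoolSymm.regularOrbits_of_comm h).containedInSumOfRegular, fun hA =>
    ⟨hA.regularOrbits.representable_two, ?_⟩⟩
  rintro (h | ⟨i, h345, h | ⟨m, D, h⟩⟩)
  · exact Or.inr ⟨h, .of_permIso h ⟨_, BoolSymm.symmetryGroup_pairingColor⟩⟩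
  · exact Or.inl fun k _ => BoolSymm.not_representable_of_permIso_cyclicPerm h345 h k
  · exact Or.inl fun k _ => BoolSymm.not_representable_of_permIso_directSum h345 h k
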